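/- **Model.** Let $N_R\ge N_T\ge 1$ and $M\ge 2$ be integers, $K\ge 0$, $E_s,N_0>0$, and $\Gamma_s=\frac{E_s}{N_0N_T}$. Let $H_{d,n}$ be a deterministic complex $N_R\times N_T$ matrix and $R_T$ a Hermitian positive definite $N_T\times N_T$ matrix. The channel matrix is $$H=H_d+\sqrt{\tfrac1{K+1}}\,H_{r,n},\qquad H_d=\sqrt{\tfrac K{K+1}}\,H_{d,n},$$ where the rows of $H_{r,n}$ are independent and their conjugate transposes are circularly-symmetric complex Gaussian $\mathcal{CN}(0,R_T)$. (The usual normalizations $\|H_{d,n}\|^2=N_TN_R$ and $[R_T]_{i,i}=1$ are allowed but not needed.) The received vector is $r=\sqrt{E_s/N_T}\,Hx+v$, where the entries of the random vector $x$ belong to the $M$-PSK constellation $\{e^{2\pi i j/M}:0\le j<M\}$, $v\sim\mathcal{CN}(0,N_0I_{N_R})$, and $H_{r,n}$, $v$, $x$ are independent. Zero-forcing (ZF) detection of Stream 1 maps the first entry of $\sqrt{N_T/E_s}\,(H^{\mathcal H}H)^{-1}H^{\mathcal H}r$ to a closest constellation symbol; $P_{e,1}$ is the probability that this symbol differs from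 $x_1$. The ZF SNR of Stream 1 is $\gamma_1=\Gamma_s/[(H^{\mathcal H}H)^{-1}]_{1,1}$, and $M_{\gamma_1}(s)=\mathbb E\{e^{s\gamma_1}\}$. Write $H_d=(h_{d,1}\;H_{d,2})$ with $h_{d,1}$ the first column, $R_{T,K}=\frac1{K+1}R_T=\begin{pmatrix}R_{11}&r_{21}^{\mathcal H}\\ r_{21}&R_{22}\end{pmatrix}$ with scalar $R_{11}$, $r_{2,1}=R_{22}^{-1}r_{21}$, $\mu=h_{d,1}-H_{d,2}r_{2,1}$, and $$N=N_R-N_T+1,\quad \Gamma_1=\frac{\Gamma_s}{[R_{T,K}^{-1}]_{1,1}},\quad a=[R_{T,K}^{-1}]_{1,1}\|\mu\|^2,\quad A_n(\sigma)=\frac{(N)_n}{(N_R)_n}\frac{\sigma^n}{n!},\quad {}_1F_1(N;N_R;\sigma)=\sum_{n\ge0}A_n(\sigma),$$ where $(\cdot)_n$ is the Pochhammer symbol. **Claim.** In all cases $$P_{e,1}=\mathbb E\Big\{\frac1\pi\int_0^{\frac{M-1}M\pi}e^{-\gamma_1\sin^2\frac\pi M/\sin^2\theta}\,d\theta\Big\}=\frac1\pi\int_0^{\frac{M-1}M\pi}M_{\gamma_1}\Big(-\frac{\sin^2\frac\pi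 M}{\sin^2\theta}\Big)d\theta .$$ 1. (Rician--Rayleigh fading.) If $H_{d,2}=0$, then $$P_{e,1}=\frac1\pi\int_0^{\frac{M-1}M\pi}\Big(\frac{\sin^2\theta}{\sin^2\theta+\Gamma_1\sin^2\frac\pi M}\Big)^{N}{}_1F_1\Big(N;N_R;-\frac{a\,\Gamma_1\sin^2\frac\pi M}{\sin^2\theta+\Gamma_1\sin^2\frac\pi M}\Big)d\theta ,$$ and also, with a convergent series, $$P_{e,1}=\sum_{n=0}^\infty A_n(a)\sum_{m=0}^n\binom nm(-1)^m\,\frac1\pi\int_0^{\frac{M-1}M\pi}\Big(\frac{\sin^2\theta}{\sin^2\theta+\Gamma_1\sin^2\frac\pi M}\Big)^{N+n-m}d\theta .$$ 2. (Rayleigh--Rician fading under the mean--correlation condition.) If $h_{d,1}=H_{d,2}\,r_{2,1}$, then $$P_{e,1}=\frac1\pi\int_0^{\frac{M-1}M\pi}\Big(\frac{\sin^2\theta}{\sin^2\theta+\Gamma_1\sin^2\frac\pi M}\Big)^{N}d\theta .$$ -/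

import Mathlib

open MeasureTheory ProbabilityTheory
open scoped Matrix ComplexOrder

namespace ZF

noncomputable section

/-- `h ∼ CN(m, R)` under `P`: `h` is a circularly-symmetric complex Gaussian random vector with mean
`m` and covariance `R = E[(h - m)(h - m)ᴴ]`, expressed through its characteristic function
`E[exp(i Re(tᴴ h))] = exp(i Re(tᴴ m) - tᴴ R t / 4)`. -/
def IsCN {Ω ι : Type*} [MeasurableSpace Ω] [Fintype ι] (P : Measure Ω)
    (h : Ω → ι → ℂ) (m : ι → ℂ) (R : Matrix ι ι ℂ) : Prop :=
  Measurable h ∧ ∀ t : ι → ℂ,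
    ∫ ω, Complex.exp (Complex.I * ((star t ⬝ᵥ h ω).re : ℂ)) ∂P
      = Complex.exp (Complex.I * ((star t ⬝ᵥ m).re : ℂ) - (star t ⬝ᵥ (R *ᵥ t)) / 4)

/-- Deterministic part `H_d = √(K/(K+1)) H_{d,n}` of the channel matrix. -/
def meanMatrix {NR NT : ℕ} (K : ℝ) (Hdn : Matrix (Fin NR) (Fin NT) ℂ) :
    Matrix (Fin NR) (Fin NT) ℂ :=
  ((Real.sqrt (K / (K + 1)) : ℝ) : ℂ) • Hdn

/-- Channel matrix `H = √(K/(K+1)) H_{d,n} + √(1/(K+1)) H_{r,n}`. -/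
def channel {NR NT : ℕ} (K : ℝ) (Hdn Hrn : Matrix (Fin NR) (Fin NT) ℂ) :
    Matrix (Fin NR) (Fin NT) ℂ :=
  meanMatrix K Hdn + ((Real.sqrt (1 / (K + 1)) : ℝ) : ℂ) • Hrn

/-- Column covariance `R_{T,K} = (1/(K+1)) R_T` of the random part of the channel matrix. -/
def covK {NT : ℕ} (K : ℝ) (RT : Matrix (Fin NT) (Fin NT) ℂ) : Matrix (Fin NT) (Fin NT) ℂ :=
  ((1 / (K + 1) : ℝ) : ℂ) • RT

/-- Per-symbol input signal-to-noise ratio `Γ_s = (E_s/N_0)(1/N_T)`. -/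
def gammaS (Es N0 : ℝ) (NT : ℕ) : ℝ := Es / N0 * (1 / (NT : ℝ))

/-- The `j`-th symbol `exp(2πij/M)` of the `M`-PSK constellation. -/
def psk (M : ℕ) (j : Fin M) : ℂ :=
  Complex.exp (2 * (Real.pi : ℂ) * Complex.I * ((j : ℕ) : ℂ) / (M : ℂ))

/-- `D` maps every complex number to (the index of) a closest `M`-PSK symbol; the way in which ties
are broken is left free. -/
def IsNearestSymbolDetector (M : ℕ) (D : ℂ → Fin M) : Prop :=
  ∀ (z : ℂ) (j : Fin M), ‖z - psk M (D z)‖ ≤ ‖z - psk M j‖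

/-- Received vector `r = √(E_s/N_T) H x + v`. -/
def received {NR NT : ℕ} (Es : ℝ) (H : Matrix (Fin NR) (Fin NT) ℂ) (x : Fin NT → ℂ)
    (v : Fin NR → ℂ) : Fin NR → ℂ :=
  ((Real.sqrt (Es / (NT : ℝ)) : ℝ) : ℂ) • (H *ᵥ x) + v

/-- Zero-forcing output `√(N_T/E_s) (HᴴH)⁻¹ Hᴴ r`. -/
def zfOutput {NR NT : ℕ} (Es : ℝ) (H : Matrix (Fin NR) (Fin NT) ℂ) (r : Fin NR → ℂ) :
    Fin NT → ℂ :=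
  ((Real.sqrt ((NT : ℝ) / Es) : ℝ) : ℂ) • (((Hᴴ * H)⁻¹ * Hᴴ) *ᵥ r)

/-- Average error probability of Stream 1 (index `0`): the probability that the detector `D`,
applied to the first component of the ZF output, does not return the transmitted symbol. -/
def errorProb {Ω : Type*} [MeasurableSpace Ω] (P : Measure Ω) {NR L M : ℕ} (Es : ℝ)
    (D : ℂ → Fin M) (H : Ω → Matrix (Fin NR) (Fin (L + 1)) ℂ)
    (sym : Ω → Fin (L + 1) → Fin M) (v : Ω → Fin NR → ℂ) : ℝ :=
  P.real {ω | D (zfOutput Es (H ω)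
    (received Es (H ω) (fun k => psk M (sym ω k)) (v ω)) 0) ≠ sym ω 0}

/-- ZF signal-to-noise ratio of Stream 1: `γ₁ = Γ_s / [(HᴴH)⁻¹]₁₁`. -/
def snr {NR L : ℕ} (Γs : ℝ) (H : Matrix (Fin NR) (Fin (L + 1)) ℂ) : ℝ :=
  Γs / (((Hᴴ * H)⁻¹) 0 0).re

/-- `M`-PSK error probability at a given SNR `γ`. -/
def condErrorProb (M : ℕ) (γ : ℝ) : ℝ :=
  1 / Real.pi * ∫ θ in (0 : ℝ)..(((M : ℝ) - 1) / (M : ℝ) * Real.pi),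
    Real.exp (-γ * (Real.sin (Real.pi / (M : ℝ)) ^ 2 / Real.sin θ ^ 2))

/-- `r_{2,1} = R₂₂⁻¹ r₂₁`, where `R₂₂` and `r₂₁` are the lower blocks of the covariance `R`. -/
def r21 {L : ℕ} (R : Matrix (Fin (L + 1)) (Fin (L + 1)) ℂ) : Fin L → ℂ :=
  (R.submatrix Fin.succ Fin.succ)⁻¹ *ᵥ (fun k => R k.succ 0)

/-- `H_{d,2} r_{2,1}`, where `H_{d,2}` consists of the columns of `H_d` other than the first. -/
def interfMeanTerm {NR L : ℕ} (Hd : Matrix (Fin NR) (Fin (L + 1)) ℂ)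
    (R : Matrix (Fin (L + 1)) (Fin (L + 1)) ℂ) : Fin NR → ℂ :=
  (Hd.submatrix id Fin.succ) *ᵥ r21 R

/-- `μ = h_{d,1} - H_{d,2} r_{2,1}`. -/
def muVec {NR L : ℕ} (Hd : Matrix (Fin NR) (Fin (L + 1)) ℂ)
    (R : Matrix (Fin (L + 1)) (Fin (L + 1)) ℂ) : Fin NR → ℂ :=
  fun i => Hd i 0 - interfMeanTerm Hd R i

/-- `a = [R⁻¹]₁₁ ‖μ‖²` (Euclidean norm). -/
def aParam {NR L : ℕ} (Hd : Matrix (Fin NR) (Fin (L + 1)) ℂ)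
    (R : Matrix (Fin (L + 1)) (Fin (L + 1)) ℂ) : ℝ :=
  ((R⁻¹) 0 0).re * ∑ i, ‖muVec Hd R i‖ ^ 2

/-- `Γ₁ = Γ_s / [R⁻¹]₁₁`. -/
def gamma1 {L : ℕ} (Γs : ℝ) (R : Matrix (Fin (L + 1)) (Fin (L + 1)) ℂ) : ℝ :=
  Γs / ((R⁻¹) 0 0).re

/-- `A_n(σ) = ((N)_n / (N_R)_n) σⁿ / n!`, with Pochhammer symbols `(·)_n`. -/
def coeffA (N NR : ℕ) (σ : ℝ) (n : ℕ) : ℝ :=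
  (ascPochhammer ℝ n).eval (N : ℝ) / (ascPochhammer ℝ n).eval (NR : ℝ)
    * (σ ^ n / (n.factorial : ℝ))

/-- The confluent hypergeometric function `₁F₁(N; N_R; σ)`. -/
def oneFone (N NR : ℕ) (σ : ℝ) : ℝ := ∑' n : ℕ, coeffA N NR σ n

/-- `(1/π) ∫₀^{(M-1)π/M} (sin²θ / (sin²θ + Γ₁ sin²(π/M)))^p dθ`. -/
def finiteIntegral (M p : ℕ) (Γ₁ : ℝ) : ℝ :=
  1 / Real.pi * ∫ θ in (0 : ℝ)..(((M : ℝ) - 1) / (M : ℝ) * Real.pi),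
    (Real.sin θ ^ 2 / (Real.sin θ ^ 2 + Γ₁ * Real.sin (Real.pi / (M : ℝ)) ^ 2)) ^ p

end

end ZF

/-! Given the channel, zero forcing removes the other streams exactly and leaves the symbol plus a
scalar circular Gaussian noise of variance `1 / γ₁` (`condErrorProb_given`). Polar coordinates
centred at the transmitted symbol turn the mass outside its decision sector into the finite-range
integral `condErrorProb` (`measureReal_isoGauss_eq_condErrorProb`). Averaging over the channel and
applying Fubini gives the m.g.f. formula (`errorProb_eq_integral`, `integral_condErrorProb`), so
everything reduces to the Laplace transform of `γ₁`.

Geometrically, `γ₁ / Γs` is the squared length of the projection of the first channel column onto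
the orthogonal complement of the others (`snr_consCol`). Regress the first column on the others: the
residual is independent of them and isotropic Gaussian with mean `μ` and variance `1 / [R⁻¹]₁₁`
(`MatGauss.map_prod`), and replacing the column by the residual does not change the projection. The
complement almost surely has dimension `N = N_R - N_T + 1`. Conditionally on the interfering
columns, the transform is therefore an explicit factor of power `N` times an exponential in the
squared projection of `μ` (`MatGauss.integral_exp_snr`).

If `μ = 0` the exponential is 1, which is the second case. If the interfering columns have mean
zero, their law is invariant under left unitary multiplication, so the complement is in uniformly
random position. The squared projection of `μ` then has moments `(N)_p / (N_R)_p ‖μ‖^(2p)`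
(`MatGauss.projMoment_eq`), and summing the exponential series gives `₁F₁`
(`MatGauss.hasSum_coeffA`). Expanding `₁F₁` binomially and integrating termwise over the angle
yields the double series (`hasSum_finiteIntegral`).

All Gaussian laws are handled through characteristic functions, which determine a finite measure and
detect independence by factorization. -/

namespace ZF

/-! ### Isotropic Gaussian measures -/

section IsoGauss

variable (V : Type*) [NormedAddCommGroup V] [InnerProductSpace ℝ V] [FiniteDimensional ℝ V]
  [MeasurableSpace V] [BorelSpace V]

/-- The centred Gaussian measure with density proportional to `exp (-‖x‖² / s)`. -/
noncomputable def isoGauss (s : ℝ) : Measure V :=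
  volume.withDensity fun x => ENNReal.ofReal
    ((Real.pi * s) ^ (-((Module.finrank ℝ V : ℝ) / 2)) * Real.exp (-(1 / s) * ‖x‖ ^ 2))

variable {V}

theorem integral_isoGauss {F : Type*} [NormedAddCommGroup F] [NormedSpace ℝ F] {s : ℝ}
    (hs : 0 < s) (f : V → F) :
    ∫ x, f x ∂(isoGauss V s) = (Real.pi * s) ^ (-((Module.finrank ℝ V : ℝ) / 2)) •
      ∫ x, Real.exp (-(1 / s) * ‖x‖ ^ 2) • f x := by
  rw [isoGauss, integral_withDensity_eq_integral_toReal_smul (by fun_prop) (by simp),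
    ← integral_smul]
  refine integral_congr_ae (.of_forall fun x => ?_)
  have : 0 < Real.pi * s := by positivity
  simp only
  rw [ENNReal.toReal_ofReal (by positivity), mul_smul]

theorem isoGauss_charFun {s : ℝ} (hs : 0 < s) (t : V) :
    ∫ x, Complex.exp (Complex.I * (inner ℝ t x : ℝ)) ∂(isoGauss V s)
      = Complex.exp (-(s * ‖t‖ ^ 2 / 4 : ℝ)) := by
  rw [integral_isoGauss hs]
  have hs' : (s : ℂ) ≠ 0 := by exact_mod_cast hs.ne'
  have h := GaussianFourier.integral_cexp_neg_mul_sq_norm_add (V := V) (b := ((1 / s : ℝ) : ℂ))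
    (by simpa using hs) Complex.I t
  have e : ∀ x : V, Real.exp (-(1 / s) * ‖x‖ ^ 2) • Complex.exp (Complex.I * (inner ℝ t x : ℝ))
      = Complex.exp (-((1 / s : ℝ) : ℂ) * ‖x‖ ^ 2 + Complex.I * (inner ℝ t x : ℝ)) := by
    intro x
    rw [Complex.exp_add, Complex.real_smul]
    push_cast
    rfl
  simp_rw [e, h]
  have hp : (0 : ℝ) < Real.pi * s := by positivity
  have e2 : ((Real.pi : ℂ) / ((1 / s : ℝ) : ℂ)) ^ ((Module.finrank ℝ V : ℂ) / 2)
      = (((Real.pi * s) ^ ((Module.finrank ℝ V : ℝ) / 2) : ℝ) : ℂ) := by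
    rw [Complex.ofReal_cpow hp.le]
    push_cast
    congr 1
    field_simp
  rw [e2, Complex.real_smul, ← mul_assoc, ← Complex.ofReal_mul, ← Real.rpow_add hp]
  simp only [neg_add_cancel, Real.rpow_zero, Complex.ofReal_one, one_mul]
  congr 1
  push_cast
  rw [Complex.I_sq]
  field_simp

/-- The characteristic function at `0` is the total mass, so no separate normalization integral is
needed. -/
theorem isProbabilityMeasure_isoGauss {s : ℝ} (hs : 0 < s) :
    IsProbabilityMeasure (isoGauss V s) := by
  have h := isoGauss_charFun (V := V) hs 0
  simp only [inner_zero_left, Complex.ofReal_zero, mul_zero, Complex.exp_zero, norm_zero, ne_eq,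
    OfNat.ofNat_ne_zero, not_false_eq_true, zero_pow, zero_div, neg_zero, integral_const,
    Complex.real_smul, mul_one] at h
  have h1 : (isoGauss V s).real Set.univ = 1 := by exact_mod_cast h
  refine ⟨?_⟩
  rw [Measure.real, ENNReal.toReal_eq_one_iff] at h1
  exact h1

theorem isoGauss_absolutelyContinuous (s : ℝ) : isoGauss V s ≪ volume :=
  withDensity_absolutelyContinuous _ _

end IsoGauss

/-! ### Gaussian laws of complex vectors and matrices -/

section Uniqueness

variable {ι κ : Type*} [Fintype ι] [Fintype κ]

/-- A real-linear functional on `ℂ^ι` is the real part of a complex-linear one. -/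
theorem exists_re_dotProduct (L : StrongDual ℝ (ι → ℂ)) :
    ∃ t : ι → ℂ, ∀ x, L x = (t ⬝ᵥ x).re := by
  classical
  -- For real `p`, `q` the real part of `(p - q * I) * z` is `p * z.re + q * z.im`, which fixes each
  -- coefficient.
  refine ⟨fun i => L (Pi.single i 1) - L (Pi.single i Complex.I) * Complex.I, fun x => ?_⟩
  have hx : x = ∑ i, ((x i).re • (Pi.single i (1 : ℂ) : ι → ℂ)
      + (x i).im • (Pi.single i Complex.I : ι → ℂ)) := by
    ext j
    simp only [Finset.sum_apply, Pi.add_apply, Pi.smul_apply, Pi.single_apply, smul_ite, smul_zero]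
    simp [Finset.sum_add_distrib, Complex.re_add_im]
  conv_lhs => rw [hx]
  simp only [map_sum, map_add, map_smul, smul_eq_mul, dotProduct, Complex.re_sum]
  refine Finset.sum_congr rfl fun i _ => ?_
  simp
  ring

theorem exists_re_sum_dotProduct (L : StrongDual ℝ (ι → κ → ℂ)) :
    ∃ T : ι → κ → ℂ, ∀ x, L x = (∑ i, T i ⬝ᵥ x i).re := by
  classical
  choose T hT using fun i => exists_re_dotProduct (L.comp (.single ℝ (fun _ => κ → ℂ) i))
  refine ⟨T, fun x => ?_⟩
  rw [Complex.re_sum, ← ContinuousLinearMap.sum_comp_single ℝ (fun _ => κ → ℂ) L x]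
  exact Finset.sum_congr rfl fun i _ => hT i (x i)

/-- The law `CN(m, s I)` on `ℂ^ι`, described by its characteristic function. -/
def VecGauss (μ : Measure (ι → ℂ)) (m : ι → ℂ) (s : ℝ) : Prop :=
  ∀ t : ι → ℂ, ∫ x, Complex.exp (Complex.I * ((t ⬝ᵥ x).re : ℂ)) ∂μ
    = Complex.exp (Complex.I * ((t ⬝ᵥ m).re : ℂ) - ((s * ∑ i, ‖t i‖ ^ 2 / 4 : ℝ) : ℂ))

/-- The law of a matrix with mean `m` and independent complex Gaussian rows whose conjugate
transposes have covariance `R`, described by its characteristic function. -/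
def MatGauss (ν : Measure (ι → κ → ℂ)) (m : ι → κ → ℂ) (R : Matrix κ κ ℂ) : Prop :=
  ∀ T : ι → κ → ℂ, ∫ G, Complex.exp (Complex.I * ((∑ i, T i ⬝ᵥ G i).re : ℂ)) ∂ν
    = Complex.exp (Complex.I * ((∑ i, T i ⬝ᵥ m i).re : ℂ)
        - (∑ i, star (T i) ⬝ᵥ (R *ᵥ T i)) / 4)

theorem MatGauss.unique {μ μ' : Measure (ι → κ → ℂ)} [IsFiniteMeasure μ] [IsFiniteMeasure μ']
    {m : ι → κ → ℂ} {R : Matrix κ κ ℂ} (h : MatGauss μ m R) (h' : MatGauss μ' m R) : μ = μ' := by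
  refine Measure.ext_of_charFunDual (funext fun L => ?_)
  obtain ⟨t, ht⟩ := exists_re_sum_dotProduct L
  simp_rw [charFunDual_apply, ht, mul_comm _ Complex.I]
  rw [h t, h' t]

/-- A measure on a product whose characteristic function factorizes is a product measure. -/
theorem eq_prod_of_charFun {ξ : Measure ((ι → ℂ) × (ι → κ → ℂ))} {μ : Measure (ι → ℂ)}
    {ν : Measure (ι → κ → ℂ)} [IsFiniteMeasure ξ] [IsFiniteMeasure μ] [IsFiniteMeasure ν]
    (h : ∀ (t : ι → ℂ) (T : ι → κ → ℂ),
      ∫ p, Complex.exp (Complex.I * ((t ⬝ᵥ p.1 + ∑ i, T i ⬝ᵥ p.2 i).re : ℂ)) ∂ξ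
        = (∫ x, Complex.exp (Complex.I * ((t ⬝ᵥ x).re : ℂ)) ∂μ)
          * ∫ G, Complex.exp (Complex.I * ((∑ i, T i ⬝ᵥ G i).re : ℂ)) ∂ν) :
    ξ = μ.prod ν := by
  refine charFunDual_eq_prod_iff.1 fun L => ?_
  obtain ⟨t, ht⟩ := exists_re_dotProduct (L.comp (.inl ℝ (ι → ℂ) (ι → κ → ℂ)))
  obtain ⟨T, hT⟩ := exists_re_sum_dotProduct (L.comp (.inr ℝ (ι → ℂ) (ι → κ → ℂ)))
  have hL : ∀ p : (ι → ℂ) × (ι → κ → ℂ), L p = (t ⬝ᵥ p.1 + ∑ i, T i ⬝ᵥ p.2 i).re := by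
    intro p
    rw [Complex.add_re, ← ht, ← hT]
    simp only [ContinuousLinearMap.comp_apply, ContinuousLinearMap.inl_apply,
      ContinuousLinearMap.inr_apply]
    rw [← map_add]
    simp
  simp_rw [charFunDual_apply, ht, hT, hL, mul_comm _ Complex.I]
  exact h t T

end Uniqueness

section Scalar

variable {ι : Type*} [Fintype ι]

/-- The image of a centred isotropic Gaussian vector under a nonzero linear form. -/
theorem VecGauss.map_dotProduct {μ : Measure (ι → ℂ)} [IsFiniteMeasure μ] {s : ℝ}
    (h : VecGauss μ 0 s) (hs : 0 < s) {b : ι → ℂ} (hb : b ≠ 0) :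
    μ.map (fun x => b ⬝ᵥ x) = isoGauss ℂ (s * ∑ i, ‖b i‖ ^ 2) := by
  have hB : 0 < ∑ i, ‖b i‖ ^ 2 := by
    obtain ⟨i, hi⟩ := Function.ne_iff.1 hb
    refine Finset.sum_pos' (fun _ _ => by positivity) ⟨i, Finset.mem_univ i, ?_⟩
    have : 0 < ‖b i‖ := norm_pos_iff.2 hi
    positivity
  have := isProbabilityMeasure_isoGauss (V := ℂ) (mul_pos hs hB)
  refine Measure.ext_of_charFun (funext fun t => ?_)
  have hm : Continuous fun x : ι → ℂ => b ⬝ᵥ x := by fun_prop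
  rw [charFun_apply, charFun_apply, integral_map hm.aemeasurable (by fun_prop)]
  have e1 : ∀ x : ι → ℂ, ((inner ℝ (b ⬝ᵥ x) t : ℝ) : ℂ) * Complex.I
      = Complex.I * ((((starRingEnd ℂ t) • b) ⬝ᵥ x).re : ℂ) := by
    intro x
    rw [mul_comm, Complex.inner, smul_dotProduct, smul_eq_mul, ← Complex.conj_re]
    simp
  simp_rw [e1]
  rw [h]
  have e2 : ∀ x : ℂ, ((inner ℝ x t : ℝ) : ℂ) * Complex.I = Complex.I * (inner ℝ t x : ℝ) := by
    intro x
    rw [mul_comm, real_inner_comm]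
  simp_rw [e2]
  rw [isoGauss_charFun (mul_pos hs hB)]
  simp only [dotProduct_zero, Complex.zero_re, Complex.ofReal_zero, mul_zero, zero_sub,
    Pi.smul_apply, norm_smul, RCLike.norm_conj, mul_pow]
  congr 3
  rw [← Finset.sum_div, ← Finset.mul_sum]
  ring

theorem VecGauss.sub_mean {μ : Measure (ι → ℂ)} {m : ι → ℂ} {s : ℝ} (h : VecGauss μ m s) :
    VecGauss (μ.map (fun x => x - m)) 0 s := by
  intro t
  rw [integral_map (by fun_prop) (by fun_prop)]
  simp only [dotProduct_sub, Complex.sub_re, Complex.ofReal_sub, mul_sub, Complex.exp_sub]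
  rw [integral_div, h t]
  simp only [Complex.exp_sub, dotProduct_zero, Complex.zero_re, Complex.ofReal_zero, mul_zero,
    Complex.exp_zero]
  field_simp

/-- Proper subspaces are null sets of isotropic Gaussian laws. -/
theorem VecGauss.measure_submodule {μ : Measure (ι → ℂ)} [IsFiniteMeasure μ] {m : ι → ℂ} {s : ℝ}
    (h : VecGauss μ m s) (hs : 0 < s) {W : Submodule ℂ (ι → ℂ)} (hW : W ≠ ⊤) :
    μ (W : Set (ι → ℂ)) = 0 := by
  classical
  obtain ⟨f, hf, hfW⟩ := W.exists_le_ker_of_lt_top hW.lt_top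
  set b : ι → ℂ := fun i => f (Pi.single i 1) with hbdef
  have hfb : ∀ x, f x = b ⬝ᵥ x := by
    intro x
    rw [LinearMap.pi_apply_eq_sum_univ f x]
    simp only [dotProduct, smul_eq_mul, hbdef]
    refine Finset.sum_congr rfl fun i _ => ?_
    rw [mul_comm]
    congr 2
    ext j
    simp [Pi.single_apply, eq_comm]
  have hb : b ≠ 0 := by
    rintro h0
    exact hf (LinearMap.ext fun x => by simp [hfb, h0])
  have h1 := h.sub_mean.map_dotProduct hs hb
  -- The form `b` vanishes on `W`, so after centring it sends all of `W` to a single point, and a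
  -- law with a density has no atoms.
  have h2 : μ (W : Set (ι → ℂ)) ≤ (isoGauss ℂ (s * ∑ i, ‖b i‖ ^ 2)) {-(b ⬝ᵥ m)} := by
    have hb1 : Continuous fun x : ι → ℂ => b ⬝ᵥ x := by fun_prop
    rw [← h1, Measure.map_apply hb1.measurable (measurableSet_singleton _),
      Measure.map_apply (by fun_prop) (hb1.measurable (measurableSet_singleton _))]
    refine measure_mono fun x hx => ?_
    have : b ⬝ᵥ x = 0 := by rw [← hfb]; exact hfW hx
    simp [dotProduct_sub, this]
  refine le_antisymm (h2.trans (le_of_eq ?_)) bot_le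
  exact isoGauss_absolutelyContinuous _ (by simp)

end Scalar

/-! ### Schur complements and the decomposition of a Gaussian matrix -/

/-- The scalar `c` is the Schur complement, reached without block inversion. It is applied both to
the covariance, with regression coefficients in `u`, and to the Gram matrix, with projection
coefficients. -/
theorem inv_zero_zero_mul {k : ℕ} {A : Matrix (Fin (k + 1)) (Fin (k + 1)) ℂ} (hA : IsUnit A.det)
    {u : Fin (k + 1) → ℂ} {c : ℂ} (hu : A *ᵥ u = Pi.single 0 c) (h0 : u 0 = 1) :
    A⁻¹ 0 0 * c = 1 := by
  have h : A⁻¹ *ᵥ (A *ᵥ u) = u := by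
    rw [Matrix.mulVec_mulVec, Matrix.nonsing_inv_mul _ hA, Matrix.one_mulVec]
  rw [hu] at h
  rw [← h0, ← h]
  simp

theorem posDef_submatrix_succ {k : ℕ} {R : Matrix (Fin (k + 1)) (Fin (k + 1)) ℂ} (hR : R.PosDef) :
    (R.submatrix Fin.succ Fin.succ).PosDef :=
  hR.submatrix (Fin.succ_injective k)

theorem PosDef.exists_inv_zero_zero {k : ℕ} {R : Matrix (Fin (k + 1)) (Fin (k + 1)) ℂ}
    (hR : R.PosDef) : 0 < (R⁻¹ 0 0).re ∧ R⁻¹ 0 0 = ((R⁻¹ 0 0).re : ℂ) := by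
  have h := hR.inv.diag_pos (i := 0)
  rw [Complex.pos_iff] at h
  exact ⟨h.1, Complex.ext rfl (by simpa using h.2.symm)⟩

/-- The regression coefficients `r21` are chosen to cancel every entry of the product but the first;
what survives is the residual variance. -/
theorem mulVec_cons_neg_r21 {k : ℕ} {R : Matrix (Fin (k + 1)) (Fin (k + 1)) ℂ} (hR : R.PosDef) :
    R *ᵥ (Fin.cons 1 (-r21 R) : Fin (k + 1) → ℂ)
      = Pi.single 0 ((((R⁻¹ 0 0).re)⁻¹ : ℝ) : ℂ) := by
  have h22 : IsUnit (R.submatrix Fin.succ Fin.succ).det :=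
    (posDef_submatrix_succ hR).det_pos.ne'.isUnit
  have h1 : (R.submatrix Fin.succ Fin.succ) *ᵥ r21 R = fun j => R j.succ 0 := by
    rw [r21, Matrix.mulVec_mulVec, Matrix.mul_nonsing_inv _ h22, Matrix.one_mulVec]
  have h2 : R *ᵥ (Fin.cons 1 (-r21 R) : Fin (k + 1) → ℂ)
      = Pi.single 0 ((R *ᵥ (Fin.cons 1 (-r21 R) : Fin (k + 1) → ℂ)) 0) := by
    ext j
    refine Fin.cases (by simp) (fun j => ?_) j
    have := congrFun h1 j
    simp only [Matrix.mulVec, dotProduct, Matrix.submatrix_apply] at this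
    simp [Matrix.mulVec, dotProduct, Fin.sum_univ_succ, this]
  have h3 := inv_zero_zero_mul hR.det_pos.ne'.isUnit h2 (by simp)
  obtain ⟨hpos, hre⟩ := PosDef.exists_inv_zero_zero hR
  rw [h2]
  congr 1
  rw [Complex.ofReal_inv, ← hre]
  exact eq_inv_of_mul_eq_one_right h3

/-- With `u = (1, -r21)` and `w = (0, T)` the test vector is `t • u + w`. Since `R u` is supported
on the first coordinate, `u` and `w` are `R`-orthogonal and the cross terms vanish. This splitting
is what makes the residual independent of the other columns. -/
theorem quadForm_cons {k : ℕ} {R : Matrix (Fin (k + 1)) (Fin (k + 1)) ℂ} (hR : R.PosDef)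
    (t : ℂ) (T : Fin k → ℂ) :
    star (Fin.cons t (T - t • r21 R) : Fin (k + 1) → ℂ)
        ⬝ᵥ (R *ᵥ (Fin.cons t (T - t • r21 R) : Fin (k + 1) → ℂ))
      = ((((R⁻¹ 0 0).re)⁻¹ * ‖t‖ ^ 2 : ℝ) : ℂ)
        + star T ⬝ᵥ ((R.submatrix Fin.succ Fin.succ) *ᵥ T) := by
  set u : Fin (k + 1) → ℂ := Fin.cons 1 (-r21 R)
  set w : Fin (k + 1) → ℂ := Fin.cons 0 T
  have hu := mulVec_cons_neg_r21 hR
  have e : (Fin.cons t (T - t • r21 R) : Fin (k + 1) → ℂ) = t • u + w := by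
    ext j
    refine Fin.cases (by simp [u, w]) (fun j => ?_) j
    simp [u, w]
    ring
  have hsym : star u ⬝ᵥ (R *ᵥ w) = 0 := by
    have : star u ⬝ᵥ (R *ᵥ w) = star (R *ᵥ u) ⬝ᵥ w := by
      rw [Matrix.star_mulVec, hR.isHermitian.eq, ← Matrix.dotProduct_mulVec]
    rw [this, hu]
    simp [dotProduct, Fin.sum_univ_succ, w]
  have hww : star w ⬝ᵥ (R *ᵥ w) = star T ⬝ᵥ ((R.submatrix Fin.succ Fin.succ) *ᵥ T) := by
    simp [dotProduct, Matrix.mulVec, Fin.sum_univ_succ, w]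
  rw [e, Matrix.mulVec_add, Matrix.mulVec_smul, hu]
  simp only [star_add, star_smul, dotProduct_add, add_dotProduct, smul_dotProduct, dotProduct_smul,
    hsym, hww, smul_zero, zero_add]
  congr 1
  have h1 : star u ⬝ᵥ (Pi.single 0 ((((R⁻¹ 0 0).re)⁻¹ : ℝ) : ℂ) : Fin (k + 1) → ℂ)
      = ((((R⁻¹ 0 0).re)⁻¹ : ℝ) : ℂ) := by
    rw [dotProduct_single]
    simp [u]
  have h2 : star w ⬝ᵥ (Pi.single 0 ((((R⁻¹ 0 0).re)⁻¹ : ℝ) : ℂ) : Fin (k + 1) → ℂ) = 0 := by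
    rw [dotProduct_single]
    simp [w]
  rw [h1, h2]
  simp only [smul_eq_mul, add_zero]
  have h3 : t * star t = ((‖t‖ ^ 2 : ℝ) : ℂ) := by
    have := Complex.mul_conj t
    rw [Complex.normSq_eq_norm_sq] at this
    exact this
  rw [Complex.ofReal_mul, ← h3]
  ring

/-- The columns of `G` other than the first. -/
def tailCols {n k : ℕ} (G : Fin n → Fin (k + 1) → ℂ) : Fin n → Fin k → ℂ := fun i j => G i j.succ

theorem measurable_tailCols {n k : ℕ} : Measurable (tailCols : (Fin n → Fin (k + 1) → ℂ) → _) := by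
  unfold tailCols
  fun_prop

theorem measurable_muVec {n k : ℕ} (R : Matrix (Fin (k + 1)) (Fin (k + 1)) ℂ) :
    Measurable (fun G : Fin n → Fin (k + 1) → ℂ => muVec (Matrix.of G) R) := by
  unfold muVec interfMeanTerm Matrix.mulVec dotProduct
  simp only [Matrix.submatrix_apply, Matrix.of_apply]
  fun_prop

/-- The adjoint of the change of variables from `G` to the pair (residual, other columns): it
produces exactly the test vectors diagonalized in `quadForm_cons`. -/
theorem dotProduct_muVec_add {n k : ℕ} (R : Matrix (Fin (k + 1)) (Fin (k + 1)) ℂ)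
    (G : Fin n → Fin (k + 1) → ℂ) (t : Fin n → ℂ) (T : Fin n → Fin k → ℂ) :
    t ⬝ᵥ muVec (Matrix.of G) R + ∑ i, T i ⬝ᵥ tailCols G i
      = ∑ i, (Fin.cons (t i) (T i - t i • r21 R) : Fin (k + 1) → ℂ) ⬝ᵥ G i := by
  rw [dotProduct, ← Finset.sum_add_distrib]
  refine Finset.sum_congr rfl fun i _ => ?_
  simp only [muVec, interfMeanTerm, Matrix.mulVec, dotProduct, tailCols, Fin.sum_univ_succ,
    Fin.cons_zero, Fin.cons_succ, Pi.sub_apply, Pi.smul_apply, smul_eq_mul, sub_mul,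
    Finset.sum_sub_distrib, mul_sub, Finset.mul_sum, Matrix.submatrix_apply, Matrix.of_apply, id]
  have : ∑ j, t i * (G i j.succ * r21 R j) = ∑ j, t i * r21 R j * G i j.succ :=
    Finset.sum_congr rfl fun j _ => by ring
  rw [this]
  ring

theorem MatGauss.joint {n k : ℕ} {ν : Measure (Fin n → Fin (k + 1) → ℂ)}
    {m : Fin n → Fin (k + 1) → ℂ} {R : Matrix (Fin (k + 1)) (Fin (k + 1)) ℂ} (hR : R.PosDef)
    (h : MatGauss ν m R) (t : Fin n → ℂ) (T : Fin n → Fin k → ℂ) :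
    ∫ G, Complex.exp (Complex.I *
        ((t ⬝ᵥ muVec (Matrix.of G) R + ∑ i, T i ⬝ᵥ tailCols G i).re : ℂ)) ∂ν
      = Complex.exp (Complex.I * ((t ⬝ᵥ muVec (Matrix.of m) R).re : ℂ)
          - ((((R⁻¹ 0 0).re)⁻¹ * ∑ i, ‖t i‖ ^ 2 / 4 : ℝ) : ℂ))
        * Complex.exp (Complex.I * ((∑ i, T i ⬝ᵥ tailCols m i).re : ℂ)
          - (∑ i, star (T i) ⬝ᵥ ((R.submatrix Fin.succ Fin.succ) *ᵥ T i)) / 4) := by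
  simp_rw [dotProduct_muVec_add]
  rw [h, ← Complex.exp_add, ← dotProduct_muVec_add]
  congr 1
  simp_rw [quadForm_cons hR]
  rw [Finset.sum_add_distrib, Complex.add_re, Complex.ofReal_add, Finset.mul_sum]
  push_cast
  rw [add_div, Finset.sum_div]
  have : ∀ i, ((R⁻¹ 0 0).re : ℂ)⁻¹ * (‖t i‖ : ℂ) ^ 2 / 4
      = ((R⁻¹ 0 0).re : ℂ)⁻¹ * ((‖t i‖ : ℂ) ^ 2 / 4) := fun i => by ring
  simp_rw [this]
  ring

theorem MatGauss.muVec {n k : ℕ} {ν : Measure (Fin n → Fin (k + 1) → ℂ)}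
    {m : Fin n → Fin (k + 1) → ℂ} {R : Matrix (Fin (k + 1)) (Fin (k + 1)) ℂ} (hR : R.PosDef)
    (h : MatGauss ν m R) :
    VecGauss (ν.map fun G => muVec (Matrix.of G) R) (muVec (Matrix.of m) R)
      (((R⁻¹ 0 0).re)⁻¹) := by
  intro t
  rw [integral_map (measurable_muVec R).aemeasurable (by fun_prop)]
  simpa using h.joint hR t 0

theorem MatGauss.tailCols {n k : ℕ} {ν : Measure (Fin n → Fin (k + 1) → ℂ)}
    {m : Fin n → Fin (k + 1) → ℂ} {R : Matrix (Fin (k + 1)) (Fin (k + 1)) ℂ} (hR : R.PosDef)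
    (h : MatGauss ν m R) :
    MatGauss (ν.map tailCols) (tailCols m) (R.submatrix Fin.succ Fin.succ) := by
  intro T
  have hc : Continuous fun G : Fin n → Fin k → ℂ =>
      Complex.exp (Complex.I * ((∑ i, T i ⬝ᵥ G i).re : ℂ)) := by fun_prop
  rw [integral_map measurable_tailCols.aemeasurable hc.aestronglyMeasurable]
  simpa using h.joint hR 0 T

/-- The residual of the first column after regression on the others is independent of them. -/
theorem MatGauss.map_prod {n k : ℕ} {ν : Measure (Fin n → Fin (k + 1) → ℂ)}
    [IsProbabilityMeasure ν]
    {m : Fin n → Fin (k + 1) → ℂ} {R : Matrix (Fin (k + 1)) (Fin (k + 1)) ℂ} (hR : R.PosDef)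
    (h : MatGauss ν m R) :
    ν.map (fun G => (ZF.muVec (Matrix.of G) R, ZF.tailCols G))
      = (ν.map fun G => ZF.muVec (Matrix.of G) R).prod (ν.map ZF.tailCols) := by
  refine eq_prod_of_charFun fun t T => ?_
  rw [h.muVec hR t, h.tailCols hR T, integral_map
    ((measurable_muVec R).prodMk measurable_tailCols).aemeasurable (by fun_prop)]
  exact h.joint hR t T

/-! ### The ZF SNR as the squared norm of a projection -/

/-- The matrix with first column `u` and further columns those of `G`. -/
def consCol {n k : ℕ} (u : Fin n → ℂ) (G : Fin n → Fin k → ℂ) : Matrix (Fin n) (Fin (k + 1)) ℂ :=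
  Matrix.of fun i => Fin.cons (u i) (G i)

theorem consCol_tailCols {n k : ℕ} (G : Fin n → Fin (k + 1) → ℂ) :
    consCol (fun i => G i 0) (tailCols G) = Matrix.of G := by
  ext i j
  refine Fin.cases ?_ (fun j => ?_) j <;> simp [consCol, tailCols]

/-- The orthogonal complement of the column space. -/
noncomputable def colPerp {n k : ℕ} (G : Fin n → Fin k → ℂ) :
    Submodule ℂ (EuclideanSpace ℂ (Fin n)) :=
  (Submodule.span ℂ (Set.range fun j => WithLp.toLp 2 fun i => G i j))ᗮ

/-- The columns of `G` are linearly independent. -/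
def ColIndep {n k : ℕ} (G : Fin n → Fin k → ℂ) : Prop :=
  LinearIndependent ℂ fun (j : Fin k) (i : Fin n) => G i j

theorem ColIndep.toLp {n k : ℕ} {G : Fin n → Fin k → ℂ} (h : ColIndep G) :
    LinearIndependent ℂ fun j => (WithLp.toLp 2 fun i => G i j : EuclideanSpace ℂ (Fin n)) :=
  h.map' (WithLp.linearEquiv 2 ℂ (Fin n → ℂ)).symm.toLinearMap (LinearEquiv.ker _)

theorem ColIndep.finrank_colPerp {n k : ℕ} {G : Fin n → Fin k → ℂ} (h : ColIndep G) :
    Module.finrank ℂ (colPerp G) = n - k := by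
  have h1 := Submodule.finrank_add_finrank_orthogonal (𝕜 := ℂ)
    (Submodule.span ℂ (Set.range fun j =>
      (WithLp.toLp 2 fun i => G i j : EuclideanSpace ℂ (Fin n))))
  rw [finrank_span_eq_card h.toLp, finrank_euclideanSpace, Fintype.card_fin, Fintype.card_fin] at h1
  exact Nat.eq_sub_of_add_eq' h1

theorem mem_span_cols {n k : ℕ} {G : Fin n → Fin k → ℂ} {x : EuclideanSpace ℂ (Fin n)}
    (hx : x ∈ Submodule.span ℂ (Set.range fun j =>
      (WithLp.toLp 2 fun i => G i j : EuclideanSpace ℂ (Fin n)))) :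
    ∃ c : Fin k → ℂ, ∀ i, x i = ∑ j, G i j * c j := by
  obtain ⟨c, hc⟩ := (Submodule.mem_span_range_iff_exists_fun ℂ).1 hx
  refine ⟨c, fun i => ?_⟩
  rw [← hc]
  simp [mul_comm]

theorem isUnit_det_gram {n k : ℕ} {H : Matrix (Fin n) (Fin k) ℂ} (h : ColIndep H) :
    IsUnit (Hᴴ * H).det := by
  refine (Matrix.PosDef.conjTranspose_mul_self H ?_).det_pos.ne'.isUnit
  exact Matrix.mulVec_injective_iff.2 h

theorem colIndep_consCol {n k : ℕ} {u : Fin n → ℂ} {G : Fin n → Fin k → ℂ} (h : ColIndep G)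
    (hu : u ∉ Submodule.span ℂ (Set.range fun (j : Fin k) (i : Fin n) => G i j)) :
    ColIndep (consCol u G) := by
  have : (fun (j : Fin (k + 1)) (i : Fin n) => consCol u G i j)
      = Fin.cons u fun (j : Fin k) (i : Fin n) => G i j := by
    ext j i
    refine Fin.cases ?_ (fun j => ?_) j <;> simp [consCol]
  have h' := linearIndependent_finCons.2 ⟨h, hu⟩
  rw [← this] at h'
  exact h'

/-- If `q` is the projection of `u` and `u - q` has coordinates `c` in the columns of `G`, then `H
(1, -c) = q`. As `q` is orthogonal to those columns, `Hᴴ q` is `‖q‖²` times the first basis vector,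
and `inv_zero_zero_mul` applies. -/
theorem snr_consCol {n k : ℕ} (Γ : ℝ) (u : Fin n → ℂ) {G : Fin n → Fin k → ℂ} (h : ColIndep G) :
    snr Γ (consCol u G) = Γ * ‖(colPerp G).starProjection (WithLp.toLp 2 u)‖ ^ 2 := by
  set W := Submodule.span ℂ (Set.range fun j =>
    (WithLp.toLp 2 fun i => G i j : EuclideanSpace ℂ (Fin n))) with hW
  set x : EuclideanSpace ℂ (Fin n) := WithLp.toLp 2 u with hx
  set q := (colPerp G).starProjection x with hq
  have hqm : q ∈ Wᗮ := Submodule.starProjection_apply_mem _ _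
  have hp : x - q ∈ W := by
    have h1 : x - q = W.starProjection x := by
      rw [hq, show colPerp G = Wᗮ from rfl, Submodule.starProjection_orthogonal]
      simp
    rw [h1]
    exact Submodule.starProjection_apply_mem _ _
  obtain ⟨c, hc⟩ := mem_span_cols hp
  set H := consCol u G with hH
  have hHu : H *ᵥ (Fin.cons 1 (-c) : Fin (k + 1) → ℂ) = q.ofLp := by
    ext i
    have := hc i
    simp only [PiLp.sub_apply, hx] at this
    simp only [hH, consCol, Matrix.mulVec, dotProduct, Fin.sum_univ_succ, Matrix.of_apply,
      Fin.cons_zero, Fin.cons_succ, Pi.neg_apply, mul_neg, Finset.sum_neg_distrib, mul_one, ← this]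
    ring
  have hAu : (Hᴴ * H) *ᵥ (Fin.cons 1 (-c) : Fin (k + 1) → ℂ)
      = Pi.single 0 ((‖q‖ ^ 2 : ℝ) : ℂ) := by
    rw [← Matrix.mulVec_mulVec, hHu]
    ext j
    refine Fin.cases ?_ (fun j => ?_) j
    · have h1 : (Hᴴ *ᵥ q.ofLp) 0 = inner ℂ x q := by
        rw [EuclideanSpace.inner_eq_star_dotProduct]
        simp [hH, consCol, Matrix.mulVec, dotProduct, hx, mul_comm]
      rw [h1, Pi.single_eq_same]
      have h2 : inner ℂ (x - q) q = 0 := hqm _ hp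
      rw [inner_sub_left, sub_eq_zero] at h2
      rw [h2, inner_self_eq_norm_sq_to_K]
      push_cast
      rfl
    · have h1 : (Hᴴ *ᵥ q.ofLp) j.succ
          = inner ℂ (WithLp.toLp 2 fun i => G i j : EuclideanSpace ℂ (Fin n)) q := by
        rw [EuclideanSpace.inner_eq_star_dotProduct]
        simp [hH, consCol, Matrix.mulVec, dotProduct, mul_comm]
      rw [h1, hqm _ (Submodule.subset_span ⟨j, rfl⟩)]
      simp
  by_cases hdet : IsUnit (Hᴴ * H).det
  · have h3 := inv_zero_zero_mul hdet hAu (by simp)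
    have h4 : ((Hᴴ * H)⁻¹ 0 0).re * ‖q‖ ^ 2 = 1 := by
      have := congrArg Complex.re h3
      rwa [Complex.re_mul_ofReal, Complex.one_re] at this
    rw [snr, eq_inv_of_mul_eq_one_left h4, div_inv_eq_mul]
  · have hu : u ∈ Submodule.span ℂ (Set.range fun (j : Fin k) (i : Fin n) => G i j) := by
      by_contra hu
      exact hdet (isUnit_det_gram (colIndep_consCol h hu))
    have hxW : x ∈ W := by
      have := Submodule.mem_map_of_mem
        (f := (WithLp.linearEquiv 2 ℂ (Fin n → ℂ)).symm.toLinearMap) hu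
      rw [Submodule.map_span, ← Set.range_comp] at this
      exact this
    have hq0 : q = 0 := by
      rw [hq, show colPerp G = Wᗮ from rfl, Submodule.starProjection_orthogonal]
      simp [Submodule.starProjection_eq_self_iff.2 hxW]
    -- Degenerate case: the inverse of a singular Gram matrix is `0` and division by `0` gives `0`,
    -- which matches `q = 0`.
    rw [snr, Matrix.nonsing_inv_apply_not_isUnit _ hdet, hq0]
    simp

theorem snr_nonneg {n k : ℕ} {Γ : ℝ} (hΓ : 0 ≤ Γ) (H : Matrix (Fin n) (Fin (k + 1)) ℂ) :
    0 ≤ snr Γ H := by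
  have h := ((Matrix.posSemidef_conjTranspose_mul_self H).inv).diag_nonneg (i := 0)
  exact div_nonneg hΓ (Complex.nonneg_iff.1 h).1

theorem snr_eq_mul {n k : ℕ} (Γ : ℝ) (H : Matrix (Fin n) (Fin (k + 1)) ℂ) :
    snr Γ H = Γ * snr 1 H := by
  simp [snr, div_eq_mul_inv]

theorem snr_unitary_mul {n k : ℕ} (Γ : ℝ) {U : Matrix (Fin n) (Fin n) ℂ} (hU : Uᴴ * U = 1)
    (H : Matrix (Fin n) (Fin (k + 1)) ℂ) : snr Γ (U * H) = snr Γ H := by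
  rw [snr, snr, Matrix.conjTranspose_mul, Matrix.mul_assoc, ← Matrix.mul_assoc Uᴴ, hU,
    Matrix.one_mul]

theorem measurable_gram_inv {n k : ℕ} (i j : Fin k) :
    Measurable fun G : Fin n → Fin k → ℂ => (((Matrix.of G)ᴴ * Matrix.of G)⁻¹) i j := by
  have h1 : Continuous fun G : Fin n → Fin k → ℂ => (Matrix.of G)ᴴ * Matrix.of G := by
    have : Continuous fun G : Fin n → Fin k → ℂ => (Matrix.of G : Matrix (Fin n) (Fin k) ℂ) :=
      continuous_id
    fun_prop
  simp only [Matrix.inv_def, Ring.inverse_eq_inv', Matrix.smul_apply, smul_eq_mul]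
  have h2 : Continuous fun G : Fin n → Fin k → ℂ => ((Matrix.of G)ᴴ * Matrix.of G).det :=
    h1.matrix_det
  have h3 : Continuous fun G : Fin n → Fin k → ℂ =>
      ((Matrix.of G)ᴴ * Matrix.of G).adjugate i j := h1.matrix_adjugate.matrix_elem i j
  exact h2.measurable.inv.mul h3.measurable

theorem measurable_snr {n k : ℕ} (Γ : ℝ) :
    Measurable fun G : Fin n → Fin (k + 1) → ℂ => snr Γ (Matrix.of G) :=
  measurable_const.div (Complex.measurable_re.comp (measurable_gram_inv 0 0))

theorem measurable_snr_consCol {n k : ℕ} (Γ : ℝ) :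
    Measurable fun p : (Fin n → ℂ) × (Fin n → Fin k → ℂ) => snr Γ (consCol p.1 p.2) := by
  refine (measurable_snr Γ).comp (g := fun G : Fin n → Fin (k + 1) → ℂ => snr Γ (Matrix.of G))
    (f := fun p : (Fin n → ℂ) × (Fin n → Fin k → ℂ) => fun i => Fin.cons (p.1 i) (p.2 i)) ?_
  refine measurable_pi_lambda _ fun i => measurable_pi_lambda _ fun j => ?_
  refine Fin.cases ?_ (fun j => ?_) j
  · simp only [Fin.cons_zero]
    fun_prop
  · simp only [Fin.cons_succ]
    fun_prop

/-! ### Laplace transform of the squared norm of a projected Gaussian vector -/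

/-- Coordinates of the projection onto `V` in an orthonormal basis of `V`. -/
noncomputable def projCoord {n : ℕ} (V : Submodule ℂ (EuclideanSpace ℂ (Fin n))) :
    EuclideanSpace ℂ (Fin n) →L[ℂ] EuclideanSpace ℂ (Fin (Module.finrank ℂ V)) :=
  (stdOrthonormalBasis ℂ V).repr.toLinearIsometry.toContinuousLinearMap ∘L
    V.orthogonalProjectionOnto

/-- The isometric inclusion of `V`, in the coordinates used by `projCoord`. -/
noncomputable def inclCoord {n : ℕ} (V : Submodule ℂ (EuclideanSpace ℂ (Fin n))) :
    EuclideanSpace ℂ (Fin (Module.finrank ℂ V)) →ₗᵢ[ℂ] EuclideanSpace ℂ (Fin n) :=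
  V.subtypeₗᵢ.comp (stdOrthonormalBasis ℂ V).repr.symm.toLinearIsometry

section Proj

variable {n : ℕ} (V : Submodule ℂ (EuclideanSpace ℂ (Fin n)))

theorem norm_projCoord (x : EuclideanSpace ℂ (Fin n)) :
    ‖projCoord V x‖ = ‖V.starProjection x‖ := by
  exact (stdOrthonormalBasis ℂ V).repr.norm_map _

theorem inner_projCoord (g : EuclideanSpace ℂ (Fin (Module.finrank ℂ V)))
    (x : EuclideanSpace ℂ (Fin n)) :
    inner ℂ g (projCoord V x) = inner ℂ (inclCoord V g) x := by
  have h : g = (stdOrthonormalBasis ℂ V).repr ((stdOrthonormalBasis ℂ V).repr.symm g) := by simp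
  conv_lhs => rw [h]
  simp only [projCoord, ContinuousLinearMap.comp_apply, LinearIsometry.coe_toContinuousLinearMap,
    LinearIsometryEquiv.coe_toLinearIsometry, LinearIsometryEquiv.inner_map_map,]
  rw [Submodule.coe_inner, ← Submodule.starProjection_apply,
    ← Submodule.inner_starProjection_left_eq_right,
    Submodule.starProjection_eq_self_iff.2 (Submodule.coe_mem _)]
  rfl

theorem real_inner_eq_re_inner_complex {d : ℕ} (x y : EuclideanSpace ℂ (Fin d)) :
    (inner ℝ x y : ℝ) = (inner ℂ x y : ℂ).re := by
  rw [PiLp.inner_apply, PiLp.inner_apply, Complex.re_sum]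
  rfl

theorem real_inner_projCoord (g : EuclideanSpace ℂ (Fin (Module.finrank ℂ V)))
    (x : EuclideanSpace ℂ (Fin n)) :
    (inner ℝ g (projCoord V x) : ℝ) = (star (inclCoord V g).ofLp ⬝ᵥ x.ofLp).re := by
  rw [real_inner_eq_re_inner_complex, inner_projCoord, EuclideanSpace.inner_eq_star_dotProduct,
    dotProduct_comm]

theorem finrank_real_euclideanSpace (d : ℕ) :
    Module.finrank ℝ (EuclideanSpace ℂ (Fin d)) = 2 * d := by
  rw [finrank_real_of_complex, finrank_euclideanSpace, Fintype.card_fin]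

/-- Laplace transform of `‖Q y‖²` for the orthogonal projection `Q` onto `V` and `y ∼ CN(m, s I)`. -/
theorem VecGauss.integral_exp_proj {μ : Measure (Fin n → ℂ)} [IsProbabilityMeasure μ]
    {m : Fin n → ℂ} {s : ℝ} (h : VecGauss μ m s) (hs : 0 < s) {c : ℝ} (hc : 0 < c) :
    ∫ x, Real.exp (-c * ‖V.starProjection (WithLp.toLp 2 x)‖ ^ 2) ∂μ
      = ((1 + c * s) ^ Module.finrank ℂ V)⁻¹
        * Real.exp (-(c * ‖V.starProjection (WithLp.toLp 2 m)‖ ^ 2 / (1 + c * s))) := by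
  set d := Module.finrank ℂ V with hd
  have h4 : 0 < 4 * c := by positivity
  have h1c : 0 < 1 + c * s := by positivity
  have := isProbabilityMeasure_isoGauss (V := EuclideanSpace ℂ (Fin d)) h4
  rw [← Complex.ofReal_inj, ← integral_complex_ofReal]
  -- The Gaussian in the projection is itself a characteristic function: variance `4 * c` is chosen
  -- so that `s / 4` becomes `c` in `isoGauss_charFun`. Fubini then brings in the characteristic
  -- function of `μ`.
  have e1 : ∀ x : Fin n → ℂ,
      ((Real.exp (-c * ‖V.starProjection (WithLp.toLp 2 x)‖ ^ 2) : ℝ) : ℂ)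
      = ∫ g, Complex.exp (Complex.I *
          ((star (inclCoord V g).ofLp ⬝ᵥ x).re : ℂ))
          ∂(isoGauss (EuclideanSpace ℂ (Fin d)) (4 * c)) := by
    intro x
    have := isoGauss_charFun h4 (projCoord V (WithLp.toLp 2 x))
    simp_rw [real_inner_comm, real_inner_projCoord] at this
    rw [this, norm_projCoord, ← Complex.ofReal_neg, ← Complex.ofReal_exp]
    congr 2
    ring
  simp_rw [e1]
  rw [integral_integral_swap]
  swap
  · have hcont : Continuous fun p : (Fin n → ℂ) × EuclideanSpace ℂ (Fin d) =>
        Complex.exp (Complex.I * ((star (inclCoord V p.2).ofLp ⬝ᵥ p.1).re : ℂ)) := by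
      have : Continuous fun p : (Fin n → ℂ) × EuclideanSpace ℂ (Fin d) =>
        (inclCoord V p.2).ofLp := (PiLp.continuous_ofLp 2 _).comp
          ((inclCoord V).continuous.comp continuous_snd)
      fun_prop
    refine (integrable_const (1 : ℝ)).mono' hcont.aestronglyMeasurable (.of_forall fun p => ?_)
    simp [Function.uncurry, Complex.norm_exp]
  simp_rw [h _]
  -- The two quadratic exponents combine as `1 / s' = 1 / (4 * c) + s / 4`. The ratio of
  -- normalizations is `(s' / (4 * c)) ^ d` and the new exponent has rate `s' / 4 = c / (1 + c *
  -- s)`.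
  set s' := 4 * c / (1 + c * s) with hs'def
  have hs' : 0 < s' := by positivity
  have h5 := isoGauss_charFun hs' (projCoord V (WithLp.toLp 2 m))
  simp_rw [real_inner_comm, real_inner_projCoord] at h5
  rw [integral_isoGauss hs'] at h5
  rw [integral_isoGauss h4]
  have e2 : ∀ g : EuclideanSpace ℂ (Fin d),
      Real.exp (-(1 / (4 * c)) * ‖g‖ ^ 2) • Complex.exp (Complex.I *
        ((star (inclCoord V g).ofLp ⬝ᵥ m).re : ℂ)
          - ((s * ∑ i, ‖star (inclCoord V g).ofLp i‖ ^ 2 / 4 : ℝ) : ℂ))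
      = Real.exp (-(1 / s') * ‖g‖ ^ 2) • Complex.exp (Complex.I *
        ((star (inclCoord V g).ofLp ⬝ᵥ m).re : ℂ)) := by
    intro g
    have hn : ∑ i, ‖star (inclCoord V g).ofLp i‖ ^ 2 / 4 = ‖g‖ ^ 2 / 4 := by
      rw [← (inclCoord V).norm_map g, EuclideanSpace.norm_sq_eq, Finset.sum_div]
      simp
    rw [hn, sub_eq_neg_add, Complex.exp_add, ← Complex.ofReal_neg, ← Complex.ofReal_exp,
      Complex.real_smul, Complex.real_smul, ← mul_assoc, ← Complex.ofReal_mul, ← Real.exp_add]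
    congr 3
    rw [hs'def]
    field_simp
    ring
  simp_rw [e2]
  have hfr : (Module.finrank ℝ (EuclideanSpace ℂ (Fin d)) : ℝ) / 2 = d := by
    rw [finrank_real_euclideanSpace]
    push_cast
    ring
  rw [hfr] at h5 ⊢
  have hp : 0 < Real.pi * s' := by positivity
  have hp4 : 0 < Real.pi * (4 * c) := by positivity
  rw [Real.rpow_neg hp.le, Real.rpow_natCast] at h5
  rw [Real.rpow_neg hp4.le, Real.rpow_natCast]
  have h6 := congrArg (fun z : ℂ => ((Real.pi * s') ^ d) • z) h5
  rw [smul_smul, mul_inv_cancel₀ (by positivity), one_smul] at h6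
  rw [h6, smul_smul, Complex.real_smul, ← Complex.ofReal_neg, ← Complex.ofReal_exp,
    ← Complex.ofReal_mul, norm_projCoord]
  congr 2
  · rw [hs'def, ← inv_pow, ← mul_pow, ← inv_pow]
    congr 1
    field_simp
  · congr 1
    rw [hs'def]
    field_simp

end Proj

/-! ### Almost sure linear independence of the columns -/

theorem span_cols_ne_top {n k : ℕ} (hk : k < n) (G : Fin n → Fin k → ℂ) :
    Submodule.span ℂ (Set.range fun (j : Fin k) (i : Fin n) => G i j) ≠ ⊤ := by
  intro h
  have h1 := finrank_range_le_card (R := ℂ) fun (j : Fin k) (i : Fin n) => G i j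
  rw [Set.finrank, h, finrank_top, Module.finrank_fintype_fun_eq_card, Fintype.card_fin,
    Fintype.card_fin] at h1
  omega

theorem starProjection_colPerp_eq_zero {n k : ℕ} {G : Fin n → Fin k → ℂ} {u : Fin n → ℂ} :
    (colPerp G).starProjection (WithLp.toLp 2 u) = 0 ↔
      u ∈ Submodule.span ℂ (Set.range fun (j : Fin k) (i : Fin n) => G i j) := by
  rw [Submodule.starProjection_apply, Submodule.coe_eq_zero,
    Submodule.orthogonalProjectionOnto_eq_zero_iff, colPerp, Submodule.orthogonal_orthogonal]
  have h : (Submodule.span ℂ (Set.range fun j =>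
      (WithLp.toLp 2 fun i => G i j : EuclideanSpace ℂ (Fin n))))
      = (Submodule.span ℂ (Set.range fun (j : Fin k) (i : Fin n) => G i j)).map
        (WithLp.linearEquiv 2 ℂ (Fin n → ℂ)).symm.toLinearMap := by
    rw [Submodule.map_span, ← Set.range_comp]
    rfl
  rw [h]
  constructor
  · rintro ⟨v, hv, hvu⟩
    have : v = u := congrArg WithLp.ofLp hvu
    rwa [← this]
  · exact fun hu => ⟨u, hu, rfl⟩

theorem muVec_sub_mem_span {n k : ℕ} (R : Matrix (Fin (k + 1)) (Fin (k + 1)) ℂ)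
    (G : Fin n → Fin (k + 1) → ℂ) :
    (fun i => G i 0) - muVec (Matrix.of G) R ∈
      Submodule.span ℂ (Set.range fun (j : Fin k) (i : Fin n) => tailCols G i j) := by
  refine (Submodule.mem_span_range_iff_exists_fun ℂ).2 ⟨r21 R, ?_⟩
  ext i
  simp [muVec, interfMeanTerm, Matrix.mulVec, dotProduct, tailCols, mul_comm]

/-- The first column and its residual differ by a combination of the other columns, which the
projection kills. -/
theorem snr_of_eq_muVec {n k : ℕ} (Γ : ℝ) (R : Matrix (Fin (k + 1)) (Fin (k + 1)) ℂ)
    {G : Fin n → Fin (k + 1) → ℂ} (h : ColIndep (tailCols G)) :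
    snr Γ (Matrix.of G) = snr Γ (consCol (muVec (Matrix.of G) R) (tailCols G)) := by
  rw [← consCol_tailCols G, snr_consCol Γ _ h, snr_consCol Γ _ h, consCol_tailCols]
  have := starProjection_colPerp_eq_zero.2 (muVec_sub_mem_span R G)
  rw [WithLp.toLp_sub, map_sub, sub_eq_zero] at this
  rw [this]

/-- Induction on the number of columns: the residual of the first column is independent of the rest
and isotropic Gaussian, so it almost surely avoids their span, a proper subspace. -/
theorem MatGauss.ae_colIndep {n : ℕ} : ∀ {k : ℕ} (_ : k ≤ n) {ν : Measure (Fin n → Fin k → ℂ)}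
    [IsProbabilityMeasure ν] {m : Fin n → Fin k → ℂ} {R : Matrix (Fin k) (Fin k) ℂ}
    (_ : R.PosDef) (_ : MatGauss ν m R), ∀ᵐ G ∂ν, ColIndep G
  | 0, _, _, _, _, _, _, _ => .of_forall fun _ => linearIndependent_empty_type
  | k + 1, hk, ν, _, m, R, hR, h => by
    have p1 : IsProbabilityMeasure (ν.map fun G => ZF.muVec (Matrix.of G) R) :=
      Measure.isProbabilityMeasure_map (measurable_muVec R).aemeasurable
    have p2 : IsProbabilityMeasure (ν.map ZF.tailCols) :=
      Measure.isProbabilityMeasure_map measurable_tailCols.aemeasurable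
    have ih := (h.tailCols hR).ae_colIndep (by omega) (posDef_submatrix_succ hR)
    have hs := inv_pos.2 (PosDef.exists_inv_zero_zero hR).1
    -- Avoiding the span is expressed as a nonzero SNR because that condition is visibly measurable
    -- in the pair, as the exchange of the two almost-everywhere quantifiers requires.
    have h1 : ∀ᵐ H ∂(ν.map ZF.tailCols), ∀ᵐ y ∂(ν.map fun G => ZF.muVec (Matrix.of G) R),
        snr 1 (consCol y H) ≠ 0 := by
      filter_upwards [ih] with H hH
      have h2 := (h.muVec hR).measure_submodule hs (span_cols_ne_top (by omega) H)
      rw [measure_eq_zero_iff_ae_notMem] at h2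
      filter_upwards [h2] with y hy
      rw [snr_consCol 1 y hH, one_mul]
      refine pow_ne_zero 2 (norm_ne_zero_iff.2 ?_)
      rw [Ne, starProjection_colPerp_eq_zero]
      exact hy
    have hm : MeasurableSet {p : (Fin n → ℂ) × (Fin n → Fin k → ℂ) |
        snr 1 (consCol p.1 p.2) ≠ 0} :=
      (measurable_snr_consCol 1 (measurableSet_singleton 0)).compl
    rw [← Measure.ae_ae_comm hm, ← Measure.ae_prod_iff_ae_ae hm, ← h.map_prod hR] at h1
    filter_upwards [ae_of_ae_map ((measurable_muVec R).prodMk measurable_tailCols).aemeasurable h1,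
      ae_of_ae_map measurable_tailCols.aemeasurable ih] with G hG1 hG2
    have h3 := colIndep_consCol (u := fun i => G i 0) hG2 fun hmem => by
      rw [← snr_of_eq_muVec 1 R hG2, ← consCol_tailCols, snr_consCol 1 _ hG2,
        starProjection_colPerp_eq_zero.2 hmem] at hG1
      simp at hG1
    rw [consCol_tailCols] at h3
    exact h3

/-- Laplace transform of the ZF SNR, as an average over the interfering columns. -/
theorem MatGauss.integral_exp_snr {n k : ℕ} (hk : k ≤ n) {ν : Measure (Fin n → Fin (k + 1) → ℂ)}
    [IsProbabilityMeasure ν] {m : Fin n → Fin (k + 1) → ℂ}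
    {R : Matrix (Fin (k + 1)) (Fin (k + 1)) ℂ} (hR : R.PosDef) (h : MatGauss ν m R)
    {c : ℝ} (hc : 0 < c) :
    ∫ G, Real.exp (-c * snr 1 (Matrix.of G)) ∂ν
      = ((1 + c * ((R⁻¹ 0 0).re)⁻¹) ^ (n - k))⁻¹ * ∫ H, Real.exp (-(c *
          snr 1 (consCol (ZF.muVec (Matrix.of m) R) H) / (1 + c * ((R⁻¹ 0 0).re)⁻¹)))
            ∂(ν.map ZF.tailCols) := by
  have p1 : IsProbabilityMeasure (ν.map fun G => ZF.muVec (Matrix.of G) R) :=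
    Measure.isProbabilityMeasure_map (measurable_muVec R).aemeasurable
  have p2 : IsProbabilityMeasure (ν.map ZF.tailCols) :=
    Measure.isProbabilityMeasure_map measurable_tailCols.aemeasurable
  have hs := inv_pos.2 (PosDef.exists_inv_zero_zero hR).1
  have hi := (h.tailCols hR).ae_colIndep hk (posDef_submatrix_succ hR)
  have hmeas : Measurable fun p : (Fin n → ℂ) × (Fin n → Fin k → ℂ) =>
      Real.exp (-c * snr 1 (consCol p.1 p.2)) :=
    Real.measurable_exp.comp ((measurable_snr_consCol 1).const_mul _)
  have e1 : ∫ G, Real.exp (-c * snr 1 (Matrix.of G)) ∂ν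
      = ∫ p, Real.exp (-c * snr 1 (consCol p.1 p.2))
        ∂((ν.map fun G => ZF.muVec (Matrix.of G) R).prod (ν.map ZF.tailCols)) := by
    rw [← h.map_prod hR, integral_map
      ((measurable_muVec R).prodMk measurable_tailCols).aemeasurable hmeas.aestronglyMeasurable]
    refine integral_congr_ae ?_
    filter_upwards [ae_of_ae_map measurable_tailCols.aemeasurable hi] with G hG
    rw [snr_of_eq_muVec 1 R hG]
  -- Integrate over the residual with the interfering columns held fixed; their complement has
  -- dimension `n - k`, whence the power.
  rw [e1, integral_prod_symm, ← integral_const_mul]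
  · refine integral_congr_ae ?_
    filter_upwards [hi] with H hH
    simp only [snr_consCol 1 _ hH, one_mul]
    rw [(h.muVec hR).integral_exp_proj (colPerp H) hs hc, hH.finrank_colPerp]
  · refine (integrable_const (1 : ℝ)).mono' hmeas.aestronglyMeasurable (.of_forall fun p => ?_)
    rw [Real.norm_eq_abs, abs_of_pos (Real.exp_pos _)]
    refine Real.exp_le_one_iff.2 ?_
    have := snr_nonneg zero_le_one (consCol p.1 p.2)
    nlinarith

/-! ### Moments of the squared norm of a standard Gaussian vector -/

theorem Gamma_add_natCast {x : ℝ} (hx : 0 < x) (p : ℕ) :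
    Real.Gamma (x + p) = (ascPochhammer ℝ p).eval x * Real.Gamma x := by
  induction p with
  | zero => simp
  | succ p ih =>
    rw [ascPochhammer_succ_eval]
    push_cast
    rw [← add_assoc, Real.Gamma_add_one (by positivity), ih]
    ring

/-- In polar coordinates the integral is `C * Γ(d + p)` with `C` independent of `p`. The case `p =
0` says `C * Γ(d) = 1`, so neither the sphere's area nor the density's constant has to be evaluated.
-/
theorem integral_norm_pow_isoGauss {d : ℕ} (hd : 0 < d) (p : ℕ) :
    ∫ v, (‖v‖ ^ 2) ^ p ∂(isoGauss (EuclideanSpace ℂ (Fin d)) 1)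
      = (ascPochhammer ℝ p).eval (d : ℝ) := by
  have : NeZero d := ⟨hd.ne'⟩
  have hG : 0 < Real.Gamma d := Real.Gamma_pos_of_pos (by exact_mod_cast hd)
  obtain ⟨C, hC⟩ : ∃ C : ℝ, ∀ p : ℕ,
      ∫ v, (‖v‖ ^ 2) ^ p ∂(isoGauss (EuclideanSpace ℂ (Fin d)) 1) = C * Real.Gamma (d + p) := by
    refine ⟨(Real.pi * 1) ^ (-((Module.finrank ℝ (EuclideanSpace ℂ (Fin d)) : ℝ) / 2))
      * (Module.finrank ℝ (EuclideanSpace ℂ (Fin d))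
        * (volume.real (Metric.ball (0 : EuclideanSpace ℂ (Fin d)) 1) * (1 / 2))), fun p => ?_⟩
    rw [integral_isoGauss one_pos]
    have h := integral_fun_norm_addHaar (volume : Measure (EuclideanSpace ℂ (Fin d)))
      fun y : ℝ => Real.exp (-(1 / 1) * y ^ 2) • (y ^ 2) ^ p
    rw [h]
    have h2 : ∫ y in Set.Ioi (0 : ℝ), y ^ (Module.finrank ℝ (EuclideanSpace ℂ (Fin d)) - 1) •
        Real.exp (-(1 / 1) * y ^ 2) • (y ^ 2) ^ p = 1 / 2 * Real.Gamma (d + p) := by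
      rw [finrank_real_euclideanSpace]
      have h3 := integral_rpow_mul_exp_neg_rpow (p := 2) (q := ((2 * d - 1 + 2 * p : ℕ) : ℝ))
        (by norm_num) (by
          have : (0 : ℝ) ≤ ((2 * d - 1 + 2 * p : ℕ) : ℝ) := Nat.cast_nonneg _
          linarith)
      have h4 : (((2 * d - 1 + 2 * p : ℕ) : ℝ) + 1) / 2 = d + p := by
        have : (2 * d - 1 + 2 * p : ℕ) + 1 = 2 * (d + p) := by omega
        have h5 : (((2 * d - 1 + 2 * p : ℕ) : ℝ) + 1) = 2 * (d + p) := by exact_mod_cast this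
        rw [h5]
        ring
      rw [h4] at h3
      rw [← h3]
      refine setIntegral_congr_fun measurableSet_Ioi fun y _ => ?_
      simp only [Real.rpow_natCast, Real.rpow_two, smul_eq_mul]
      rw [pow_add, ← pow_mul]
      norm_num
      ring
    rw [h2]
    simp only [smul_eq_mul, nsmul_eq_mul]
    ring
  have h0 := hC 0
  have := isProbabilityMeasure_isoGauss (V := EuclideanSpace ℂ (Fin d)) one_pos
  simp only [pow_zero, integral_const, smul_eq_mul, mul_one, Nat.cast_zero, add_zero,
    probReal_univ] at h0
  rw [hC p, Gamma_add_natCast (by exact_mod_cast hd), mul_left_comm, ← h0, mul_one]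

theorem ascPochhammer_eval_pos {d : ℕ} (hd : 0 < d) (p : ℕ) :
    0 < (ascPochhammer ℝ p).eval (d : ℝ) :=
  ascPochhammer_pos p _ (by exact_mod_cast hd)

theorem integrable_norm_pow_isoGauss {d : ℕ} (hd : 0 < d) (p : ℕ) :
    Integrable (fun v => (‖v‖ ^ 2) ^ p) (isoGauss (EuclideanSpace ℂ (Fin d)) 1) := by
  -- A non-integrable function has integral `0` by convention, contradicting the positive value just
  -- found.
  by_contra h
  have h1 := integral_norm_pow_isoGauss hd p
  rw [integral_undef h] at h1
  exact (ascPochhammer_eval_pos hd p).ne h1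

theorem isoGauss_map_projCoord {n : ℕ} (V : Submodule ℂ (EuclideanSpace ℂ (Fin n))) :
    (isoGauss (EuclideanSpace ℂ (Fin n)) 1).map (projCoord V)
      = isoGauss (EuclideanSpace ℂ (Fin (Module.finrank ℂ V))) 1 := by
  have := isProbabilityMeasure_isoGauss (V := EuclideanSpace ℂ (Fin n)) one_pos
  have := isProbabilityMeasure_isoGauss
    (V := EuclideanSpace ℂ (Fin (Module.finrank ℂ V))) one_pos
  refine Measure.ext_of_charFun (funext fun t => ?_)
  rw [charFun_apply, charFun_apply,
    integral_map (projCoord V).continuous.aemeasurable (by fun_prop)]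
  have e1 : ∀ x, ((inner ℝ (projCoord V x) t : ℝ) : ℂ) * Complex.I
      = Complex.I * (inner ℝ (inclCoord V t) x : ℝ) := by
    intro x
    rw [mul_comm, real_inner_comm, real_inner_eq_re_inner_complex, inner_projCoord,
      ← real_inner_eq_re_inner_complex]
  have e2 : ∀ x : EuclideanSpace ℂ (Fin (Module.finrank ℂ V)),
      ((inner ℝ x t : ℝ) : ℂ) * Complex.I = Complex.I * (inner ℝ t x : ℝ) := by
    intro x
    rw [mul_comm, real_inner_comm]
  simp_rw [e1, e2]
  rw [isoGauss_charFun one_pos, isoGauss_charFun one_pos, (inclCoord V).norm_map]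

theorem integral_norm_proj_pow {n : ℕ} (V : Submodule ℂ (EuclideanSpace ℂ (Fin n)))
    (hV : 0 < Module.finrank ℂ V) (p : ℕ) :
    ∫ u, (‖V.starProjection u‖ ^ 2) ^ p ∂(isoGauss (EuclideanSpace ℂ (Fin n)) 1)
      = (ascPochhammer ℝ p).eval (Module.finrank ℂ V : ℝ) := by
  rw [← integral_norm_pow_isoGauss hV p, ← isoGauss_map_projCoord V,
    integral_map (projCoord V).continuous.aemeasurable (by fun_prop)]
  simp_rw [norm_projCoord]

/-! ### Unitary invariance -/

/-- Unless both vectors are zero, extend their normalizations to orthonormal bases and map one basis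
to the other. -/
theorem exists_unitary_mulVec {n : ℕ} {u w : EuclideanSpace ℂ (Fin n)} (h : ‖u‖ = ‖w‖) :
    ∃ U : Matrix (Fin n) (Fin n) ℂ, Uᴴ * U = 1 ∧ U *ᵥ u.ofLp = w.ofLp := by
  classical
  obtain ⟨f, hf⟩ : ∃ f : EuclideanSpace ℂ (Fin n) ≃ₗᵢ[ℂ] EuclideanSpace ℂ (Fin n), f u = w := by
    by_cases hu : u = 0
    · refine ⟨LinearIsometryEquiv.refl ℂ _, ?_⟩
      have : w = 0 := by rw [← norm_eq_zero, ← h, hu, norm_zero]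
      simp [hu, this]
    · have hn : (‖u‖ : ℂ) ≠ 0 := by exact_mod_cast norm_ne_zero_iff.2 hu
      have hi : Nonempty (Fin n) := by
        by_contra hne
        rw [not_nonempty_iff] at hne
        exact hu (Subsingleton.elim _ _)
      obtain ⟨i⟩ := hi
      have key : ∀ v : EuclideanSpace ℂ (Fin n), ‖v‖ = ‖u‖ →
          ∃ b : OrthonormalBasis (Fin n) ℂ (EuclideanSpace ℂ (Fin n)), (‖u‖ : ℂ) • b i = v := by
        intro v hv
        obtain ⟨b, hb⟩ := Orthonormal.exists_orthonormalBasis_extension_of_card_eq (𝕜 := ℂ)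
          (E := EuclideanSpace ℂ (Fin n)) (ι := Fin n) (by simp)
          (v := fun _ => (‖u‖ : ℂ)⁻¹ • v) (s := {i}) (by
            refine ⟨fun j => ?_, fun j k hjk => (hjk (Subsingleton.elim _ _)).elim⟩
            have : ‖u‖ ≠ 0 := norm_ne_zero_iff.2 hu
            simp [norm_smul, hv, this])
        refine ⟨b, ?_⟩
        rw [hb i rfl, smul_inv_smul₀ hn]
      obtain ⟨b, hb⟩ := key u rfl
      obtain ⟨b', hb'⟩ := key w h.symm
      refine ⟨b.equiv b' (Equiv.refl _), ?_⟩
      conv_lhs => rw [← hb]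
      rw [map_smul, OrthonormalBasis.equiv_apply_basis, Equiv.refl_apply, hb']
  refine ⟨Matrix.of fun i j => f (EuclideanSpace.single j 1) i, ?_, ?_⟩
  · ext j k
    have h1 : inner ℂ (f (EuclideanSpace.single j 1)) (f (EuclideanSpace.single k 1))
        = (1 : Matrix (Fin n) (Fin n) ℂ) j k := by
      rw [f.inner_map_map, EuclideanSpace.inner_single_left]
      simp [Matrix.one_apply]
    rw [← h1, EuclideanSpace.inner_eq_star_dotProduct]
    simp [Matrix.mul_apply, dotProduct, mul_comm]
  · have h2 : u = ∑ j, u j • EuclideanSpace.single j (1 : ℂ) := by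
      ext i
      simp [Finset.sum_apply, Pi.single_apply]
    ext i
    rw [← hf]
    conv_rhs => rw [h2]
    simp [Matrix.mulVec, dotProduct, mul_comm]

/-- Left multiplication of the matrix `H` by `U`. -/
def leftMul {n k : ℕ} (U : Matrix (Fin n) (Fin n) ℂ) (H : Fin n → Fin k → ℂ) :
    Fin n → Fin k → ℂ := fun i j => (U * Matrix.of H) i j

theorem continuous_leftMul {n k : ℕ} (U : Matrix (Fin n) (Fin n) ℂ) :
    Continuous (leftMul U : (Fin n → Fin k → ℂ) → _) := by
  unfold leftMul
  simp only [Matrix.mul_apply, Matrix.of_apply]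
  fun_prop

/-- In trace form `T` enters only through `Tᵀ` times its entrywise conjugate, which a unitary factor
on the left of `T` leaves unchanged. -/
theorem sum_quadForm_eq_trace {n k : ℕ} (R : Matrix (Fin k) (Fin k) ℂ) (T : Fin n → Fin k → ℂ) :
    ∑ i, star (T i) ⬝ᵥ (R *ᵥ T i)
      = (R * ((Matrix.of T)ᵀ * ((Matrix.of T)ᴴ)ᵀ)).trace := by
  rw [← Matrix.mul_assoc, Matrix.trace_mul_comm, Matrix.trace]
  refine Finset.sum_congr rfl fun i _ => ?_
  simp [Matrix.mul_apply, Matrix.diag, dotProduct, Matrix.mulVec]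

theorem sum_dotProduct_leftMul {n k : ℕ} (U : Matrix (Fin n) (Fin n) ℂ) (T H : Fin n → Fin k → ℂ) :
    ∑ i, T i ⬝ᵥ leftMul U H i = ∑ i, leftMul Uᵀ T i ⬝ᵥ H i := by
  simp only [leftMul, dotProduct, Matrix.mul_apply, Matrix.of_apply, Matrix.transpose_apply,
    Finset.mul_sum, Finset.sum_mul]
  rw [Finset.sum_comm]
  conv_rhs => rw [Finset.sum_comm]
  refine Finset.sum_congr rfl fun j _ => ?_
  rw [Finset.sum_comm]
  exact Finset.sum_congr rfl fun i _ => Finset.sum_congr rfl fun l _ => by ring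

/-- Independent rows with a common covariance may be mixed by a unitary matrix. A zero mean is
essential, since a nonzero one would be rotated. -/
theorem MatGauss.map_leftMul {n k : ℕ} {ν : Measure (Fin n → Fin k → ℂ)} [IsProbabilityMeasure ν]
    {R : Matrix (Fin k) (Fin k) ℂ} (h : MatGauss ν 0 R) {U : Matrix (Fin n) (Fin n) ℂ}
    (hU : Uᴴ * U = 1) : ν.map (leftMul U) = ν := by
  have := Measure.isProbabilityMeasure_map (μ := ν) (continuous_leftMul U).aemeasurable
  have hU' : U * Uᴴ = 1 := mul_eq_one_comm.1 hU
  refine MatGauss.unique (m := 0) (R := R) (fun T => ?_) h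
  have hc : Continuous fun G : Fin n → Fin k → ℂ =>
      Complex.exp (Complex.I * ((∑ i, T i ⬝ᵥ G i).re : ℂ)) := by fun_prop
  rw [integral_map (continuous_leftMul U).aemeasurable hc.aestronglyMeasurable]
  simp_rw [sum_dotProduct_leftMul]
  rw [h, sum_quadForm_eq_trace, sum_quadForm_eq_trace]
  have e : (Matrix.of (leftMul Uᵀ T))ᵀ * ((Matrix.of (leftMul Uᵀ T))ᴴ)ᵀ
      = (Matrix.of T)ᵀ * ((Matrix.of T)ᴴ)ᵀ := by
    have e1 : Matrix.of (leftMul Uᵀ T) = Uᵀ * Matrix.of T := rfl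
    have e2 : ((Uᵀ)ᴴ)ᵀ = Uᴴ := by
      ext i j
      simp
    rw [e1, Matrix.transpose_mul, Matrix.transpose_transpose, Matrix.conjTranspose_mul,
      Matrix.transpose_mul, e2, Matrix.mul_assoc, ← Matrix.mul_assoc U, hU', Matrix.one_mul]
  rw [e]
  simp

theorem consCol_mulVec {n k : ℕ} (U : Matrix (Fin n) (Fin n) ℂ) (u : Fin n → ℂ)
    (H : Fin n → Fin k → ℂ) : consCol (U *ᵥ u) (leftMul U H) = U * consCol u H := by
  ext i j
  refine Fin.cases ?_ (fun j => ?_) j <;>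
    simp [consCol, leftMul, Matrix.mul_apply, Matrix.mulVec, dotProduct]

theorem measurable_snr_consCol_left {n k : ℕ} (u : Fin n → ℂ) :
    Measurable fun H : Fin n → Fin k → ℂ => snr 1 (consCol u H) :=
  (measurable_snr_consCol 1).comp
    (g := fun p : (Fin n → ℂ) × (Fin n → Fin k → ℂ) => snr 1 (consCol p.1 p.2))
    (f := fun H => (u, H)) measurable_prodMk_left

/-- Moments of the squared projection of `u` onto the orthogonal complement of the columns. -/
noncomputable def projMoment {n k : ℕ} (ν : Measure (Fin n → Fin k → ℂ)) (p : ℕ)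
    (u : EuclideanSpace ℂ (Fin n)) : ℝ := ∫ H, snr 1 (consCol u.ofLp H) ^ p ∂ν

theorem MatGauss.projMoment_eq_of_norm_eq {n k : ℕ} {ν : Measure (Fin n → Fin k → ℂ)}
    [IsProbabilityMeasure ν] {R : Matrix (Fin k) (Fin k) ℂ} (h : MatGauss ν 0 R) (p : ℕ)
    {u w : EuclideanSpace ℂ (Fin n)} (huw : ‖u‖ = ‖w‖) : projMoment ν p u = projMoment ν p w := by
  obtain ⟨U, hU, hUw⟩ := exists_unitary_mulVec huw
  rw [projMoment, projMoment, ← hUw]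
  conv_rhs => rw [← h.map_leftMul hU]
  rw [integral_map (continuous_leftMul U).aemeasurable
    ((measurable_snr_consCol_left _).pow_const p).aestronglyMeasurable]
  simp_rw [consCol_mulVec, snr_unitary_mul 1 hU]

theorem snr_consCol_le {n k : ℕ} (u : EuclideanSpace ℂ (Fin n)) {H : Fin n → Fin k → ℂ}
    (hH : ColIndep H) : snr 1 (consCol u.ofLp H) ≤ ‖u‖ ^ 2 := by
  rw [snr_consCol 1 _ hH, one_mul]
  gcongr
  exact Submodule.norm_starProjection_apply_le _ _

theorem projMoment_smul {n k : ℕ} {ν : Measure (Fin n → Fin k → ℂ)} (hν : ∀ᵐ H ∂ν, ColIndep H)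
    (p : ℕ) (c : ℂ) (u : EuclideanSpace ℂ (Fin n)) :
    projMoment ν p (c • u) = (‖c‖ ^ 2) ^ p * projMoment ν p u := by
  rw [projMoment, projMoment, ← integral_const_mul]
  refine integral_congr_ae ?_
  filter_upwards [hν] with H hH
  rw [snr_consCol 1 _ hH, snr_consCol 1 _ hH]
  simp [norm_smul, mul_pow]

/-- The moments of the squared projection are those of a scaled beta variable. -/
theorem MatGauss.projMoment_eq {n k : ℕ} (hk : k < n) {ν : Measure (Fin n → Fin k → ℂ)}
    [IsProbabilityMeasure ν] {R : Matrix (Fin k) (Fin k) ℂ} (hR : R.PosDef) (h : MatGauss ν 0 R)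
    (p : ℕ) (u : EuclideanSpace ℂ (Fin n)) :
    projMoment ν p u = (ascPochhammer ℝ p).eval ((n - k : ℕ) : ℝ)
      / (ascPochhammer ℝ p).eval (n : ℝ) * (‖u‖ ^ 2) ^ p := by
  have hn : 0 < n := by omega
  have hν := h.ae_colIndep hk.le hR
  set e : EuclideanSpace ℂ (Fin n) := EuclideanSpace.single ⟨0, hn⟩ 1 with he
  have hu : ∀ u, projMoment ν p u = (‖u‖ ^ 2) ^ p * projMoment ν p e := by
    intro u
    have h1 : ‖u‖ = ‖(‖u‖ : ℂ) • e‖ := by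
      rw [norm_smul, he, PiLp.norm_single]
      simp
    rw [h.projMoment_eq_of_norm_eq p h1, projMoment_smul hν, Complex.norm_real, norm_norm]
  have := isProbabilityMeasure_isoGauss (V := EuclideanSpace ℂ (Fin n)) one_pos
  -- Homogeneity and unitary invariance leave a single unknown, the moment at `e`. Averaging `u`
  -- over a standard Gaussian finds it in two ways: here through `‖u‖`, and in `h3` with the columns
  -- fixed, where the projection of `u` is standard Gaussian in dimension `n - k`.
  have h2 : ∫ u, projMoment ν p u ∂(isoGauss (EuclideanSpace ℂ (Fin n)) 1)
      = (ascPochhammer ℝ p).eval (n : ℝ) * projMoment ν p e := by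
    rw [integral_congr_ae (.of_forall hu), integral_mul_const, integral_norm_pow_isoGauss hn]
  have hmeas : Measurable fun q : EuclideanSpace ℂ (Fin n) × (Fin n → Fin k → ℂ) =>
      snr 1 (consCol q.1.ofLp q.2) :=
    (measurable_snr_consCol 1).comp
      (g := fun p : (Fin n → ℂ) × (Fin n → Fin k → ℂ) => snr 1 (consCol p.1 p.2))
      (f := fun q : EuclideanSpace ℂ (Fin n) × (Fin n → Fin k → ℂ) => (q.1.ofLp, q.2))
      (((PiLp.continuous_ofLp 2 _).measurable.comp measurable_fst).prodMk measurable_snd)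
  have h3 : ∫ u, projMoment ν p u ∂(isoGauss (EuclideanSpace ℂ (Fin n)) 1)
      = (ascPochhammer ℝ p).eval ((n - k : ℕ) : ℝ) := by
    simp only [projMoment]
    rw [integral_integral_swap]
    · have h4 : ∀ᵐ H ∂ν, ∫ u, snr 1 (consCol u.ofLp H) ^ p
          ∂(isoGauss (EuclideanSpace ℂ (Fin n)) 1)
          = (ascPochhammer ℝ p).eval ((n - k : ℕ) : ℝ) := by
        filter_upwards [hν] with H hH
        simp_rw [snr_consCol 1 _ hH, one_mul]
        rw [← hH.finrank_colPerp]
        exact integral_norm_proj_pow _ (by rw [hH.finrank_colPerp]; omega) p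
      rw [integral_congr_ae h4]
      simp
    · refine ((integrable_norm_pow_isoGauss hn p).comp_fst ν).mono'
        (hmeas.pow_const p).aestronglyMeasurable ?_
      have hms : MeasurableSet {q : EuclideanSpace ℂ (Fin n) × (Fin n → Fin k → ℂ) |
          ‖snr 1 (consCol q.1.ofLp q.2) ^ p‖ ≤ (‖q.1‖ ^ 2) ^ p} :=
        measurableSet_le (hmeas.pow_const p).norm (by fun_prop)
      refine (Measure.ae_prod_iff_ae_ae hms).2 (.of_forall fun u => ?_)
      filter_upwards [hν] with H hH
      have h5 := snr_nonneg zero_le_one (consCol u.ofLp H)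
      rw [Real.norm_eq_abs, abs_of_nonneg (by positivity)]
      exact pow_le_pow_left₀ h5 (snr_consCol_le u hH) p
  have h6 := ascPochhammer_eval_pos hn p
  have h7 : projMoment ν p e = (ascPochhammer ℝ p).eval ((n - k : ℕ) : ℝ)
      / (ascPochhammer ℝ p).eval (n : ℝ) :=
    eq_div_of_mul_eq h6.ne' (by rw [mul_comm, ← h2, h3])
  rw [hu u, h7, mul_comm]

/-- Expand the exponential and integrate termwise; the bound of the squared projection by `‖u‖²`
supplies a summable majorant. The sign of `c` is free: positive values give Laplace transforms,
while a negative one gives summability of the series at `a`. -/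
theorem MatGauss.hasSum_coeffA {n k : ℕ} (hk : k < n) {ν : Measure (Fin n → Fin k → ℂ)}
    [IsProbabilityMeasure ν] {R : Matrix (Fin k) (Fin k) ℂ} (hR : R.PosDef) (h : MatGauss ν 0 R)
    (c : ℝ) (u : EuclideanSpace ℂ (Fin n)) :
    HasSum (coeffA (n - k) n (-(c * ‖u‖ ^ 2)))
      (∫ H, Real.exp (-(c * snr 1 (consCol u.ofLp H))) ∂ν) := by
  have hν := h.ae_colIndep hk.le hR
  have hm := measurable_snr_consCol_left (k := k) u.ofLp
  have hbd : ∀ p : ℕ, ∀ᵐ H ∂ν, ‖(-(c * snr 1 (consCol u.ofLp H))) ^ p / (p.factorial : ℝ)‖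
      ≤ (|c| * ‖u‖ ^ 2) ^ p / (p.factorial : ℝ) := by
    intro p
    filter_upwards [hν] with H hH
    have h5 := snr_nonneg zero_le_one (consCol u.ofLp H)
    rw [norm_div, norm_pow, Real.norm_natCast, norm_neg, norm_mul, Real.norm_eq_abs,
      Real.norm_eq_abs, abs_of_nonneg h5]
    gcongr
    exact snr_consCol_le u hH
  have hint : ∀ p : ℕ, Integrable
      (fun H => (-(c * snr 1 (consCol u.ofLp H))) ^ p / (p.factorial : ℝ)) ν := fun p =>
    (integrable_const _).mono' (((hm.const_mul c).neg.pow_const p).div_const _).aestronglyMeasurable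
      (hbd p)
  have hs := hasSum_integral_of_summable_integral_norm hint (by
    refine Summable.of_nonneg_of_le (fun p => integral_nonneg fun _ => norm_nonneg _) (fun p => ?_)
      (Real.summable_pow_div_factorial (|c| * ‖u‖ ^ 2))
    calc _ ≤ ∫ _, (|c| * ‖u‖ ^ 2) ^ p / (p.factorial : ℝ) ∂ν :=
          integral_mono_ae (hint p).norm (integrable_const _) (hbd p)
      _ = _ := by simp)
  have e1 : coeffA (n - k) n (-(c * ‖u‖ ^ 2)) = fun p : ℕ =>
      ∫ H, (-(c * snr 1 (consCol u.ofLp H))) ^ p / (p.factorial : ℝ) ∂ν := by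
    ext p
    rw [integral_div]
    have e : ∀ H : Fin n → Fin k → ℂ, (-(c * snr 1 (consCol u.ofLp H))) ^ p
        = (-c) ^ p * snr 1 (consCol u.ofLp H) ^ p := fun H => by rw [← neg_mul, mul_pow]
    simp_rw [e]
    rw [integral_const_mul]
    have := h.projMoment_eq hk hR p u
    rw [projMoment] at this
    rw [this, coeffA, ← neg_mul, mul_pow]
    ring
  have e2 : ∫ H, Real.exp (-(c * snr 1 (consCol u.ofLp H))) ∂ν
      = ∫ H, ∑' p : ℕ, (-(c * snr 1 (consCol u.ofLp H))) ^ p / (p.factorial : ℝ) ∂ν := by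
    simp_rw [Real.exp_eq_exp_ℝ, NormedSpace.exp_eq_tsum_div]
  rw [e1, e2]
  exact hs

/-! ### The `M`-PSK decision regions -/

/-- Writing the symbol's angle as `2 * α` puts the bisector between it and `1` in direction `α`; the
last factor is the signed side of that line. -/
theorem norm_sq_sub_exp (z : ℂ) (α : ℝ) :
    ‖z - Complex.exp ((2 * α : ℝ) * Complex.I)‖ ^ 2 - ‖z - 1‖ ^ 2
      = 4 * Real.sin α * (z.re * Real.sin α - z.im * Real.cos α) := by
  rw [← Complex.normSq_eq_norm_sq, ← Complex.normSq_eq_norm_sq, Complex.normSq_apply,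
    Complex.normSq_apply]
  simp only [Complex.sub_re, Complex.sub_im, Complex.exp_ofReal_mul_I_re,
    Complex.exp_ofReal_mul_I_im, Complex.one_re, Complex.one_im]
  rw [Real.cos_two_mul', Real.sin_two_mul]
  linear_combination (1 - 2 * z.re + (Real.cos α ^ 2 + Real.sin α ^ 2)) *
    Real.sin_sq_add_cos_sq α

theorem psk_eq_exp (M : ℕ) (j : Fin M) :
    psk M j = Complex.exp ((2 * ((j : ℕ) * (Real.pi / M)) : ℝ) * Complex.I) := by
  rw [psk]
  congr 1
  push_cast
  ring

theorem norm_psk (M : ℕ) (j : Fin M) : ‖psk M j‖ = 1 := by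
  rw [psk_eq_exp, Complex.norm_exp_ofReal_mul_I]

/-- If `z` is strictly closer to `1` than to its two neighbours, it is closest to `1`. -/
theorem sector_subset {A x y : ℝ} (hA : 0 < Real.sin A) (h : |y| * Real.cos A < x * Real.sin A)
    {α : ℝ} (h1 : 0 ≤ Real.sin (α - A)) (h2 : 0 ≤ Real.sin (α + A)) (h3 : 0 < Real.sin α) :
    y * Real.cos α < x * Real.sin α := by
  have e1 := Real.sin_sub α A
  have e2 := Real.sin_add α A
  -- The difference of the two sides is `|y| * sin (α - A)` for `y ≥ 0` and `|y| * sin (α + A)` for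
  -- `y < 0`.
  have h4 : y * Real.cos α * Real.sin A ≤ |y| * Real.cos A * Real.sin α := by
    rcases abs_cases y with ⟨hy, hy'⟩ | ⟨hy, hy'⟩
    · rw [hy]
      nlinarith
    · rw [hy]
      nlinarith
  nlinarith

theorem sin_pi_div_pos {M : ℕ} (hM : 2 ≤ M) : 0 < Real.sin (Real.pi / M) := by
  have h2 : (2 : ℝ) ≤ M := by exact_mod_cast hM
  refine Real.sin_pos_of_pos_of_lt_pi (by positivity) ?_
  rw [div_lt_iff₀ (by linarith)]
  nlinarith [Real.pi_pos]

theorem pi_div_le {M : ℕ} (hM : 2 ≤ M) : Real.pi / M ≤ Real.pi / 2 := by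
  have h2 : (2 : ℝ) ≤ M := by exact_mod_cast hM
  exact div_le_div_of_nonneg_left Real.pi_pos.le (by norm_num) h2

/-- Half the symbol's angle is `j π / M` with `1 ≤ j ≤ M - 1`, so moving by `π / M` either way stays
in `[0, π]`. -/
theorem psk_angle {M : ℕ} (hM : 2 ≤ M) {j : Fin M} (hj : (j : ℕ) ≠ 0) :
    0 < Real.sin ((j : ℕ) * (Real.pi / M)) ∧
    0 ≤ Real.sin ((j : ℕ) * (Real.pi / M) - Real.pi / M) ∧
    0 ≤ Real.sin ((j : ℕ) * (Real.pi / M) + Real.pi / M) := by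
  have hM0 : (0 : ℝ) < M := by exact_mod_cast (by omega : 0 < M)
  set A := Real.pi / M with hA
  have hA0 : 0 < A := by positivity
  have hMA : M * A = Real.pi := by rw [hA]; field_simp
  have h1 : (1 : ℝ) ≤ (j : ℕ) := by exact_mod_cast Nat.one_le_iff_ne_zero.2 hj
  have h2 : ((j : ℕ) : ℝ) + 1 ≤ M := by exact_mod_cast j.2
  refine ⟨Real.sin_pos_of_pos_of_lt_pi (by positivity) (by nlinarith),
    Real.sin_nonneg_of_nonneg_of_le_pi (by nlinarith) (by nlinarith),
    Real.sin_nonneg_of_nonneg_of_le_pi (by positivity) (by nlinarith)⟩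

/-- Only the two neighbours, of indices `1` and `M - 1`, are needed: their bisectors bound the
sector. For `M = 2` they coincide and the sector is a half-plane. -/
theorem sector_of_forall_le {M : ℕ} (hM : 2 ≤ M) {z : ℂ}
    (h : ∀ j : Fin M, ‖z - 1‖ ≤ ‖z - psk M j‖) :
    |z.im| * Real.cos (Real.pi / M) ≤ z.re * Real.sin (Real.pi / M) := by
  have hs := sin_pi_div_pos hM
  have h1 := h ⟨1, by omega⟩
  have h2 := h ⟨M - 1, by omega⟩
  rw [psk_eq_exp] at h1 h2
  have e1 := norm_sq_sub_exp z (((1 : ℕ) : ℝ) * (Real.pi / M))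
  have e2 := norm_sq_sub_exp z (((M - 1 : ℕ) : ℝ) * (Real.pi / M))
  simp only at h1 h2
  have h1' := pow_le_pow_left₀ (norm_nonneg _) h1 2
  have h2' := pow_le_pow_left₀ (norm_nonneg _) h2 2
  have h3 : ((M - 1 : ℕ) : ℝ) * (Real.pi / M) = Real.pi - Real.pi / M := by
    have : (M : ℝ) ≠ 0 := by exact_mod_cast (by omega : M ≠ 0)
    rw [Nat.cast_sub (by omega)]
    field_simp
    push_cast
    ring
  rw [h3] at e2 h2'
  rw [Real.sin_pi_sub, Real.cos_pi_sub] at e2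
  rw [Nat.cast_one, one_mul] at e1 h1'
  have k1 : 0 ≤ z.re * Real.sin (Real.pi / M) - z.im * Real.cos (Real.pi / M) :=
    nonneg_of_mul_nonneg_right (by linarith) (by positivity : 0 < 4 * Real.sin (Real.pi / M))
  have k2 : 0 ≤ z.re * Real.sin (Real.pi / M) - z.im * -Real.cos (Real.pi / M) :=
    nonneg_of_mul_nonneg_right (by linarith) (by positivity : 0 < 4 * Real.sin (Real.pi / M))
  rcases abs_cases z.im with ⟨hy, _⟩ | ⟨hy, _⟩ <;> rw [hy] <;> linarith

theorem lt_of_mem_sector {M : ℕ} (hM : 2 ≤ M) {z : ℂ}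
    (h : |z.im| * Real.cos (Real.pi / M) < z.re * Real.sin (Real.pi / M))
    {j : Fin M} (hj : (j : ℕ) ≠ 0) : ‖z - 1‖ < ‖z - psk M j‖ := by
  obtain ⟨h3, h1, h2⟩ := psk_angle hM hj
  have h4 := sector_subset (sin_pi_div_pos hM) h h1 h2 h3
  have e := norm_sq_sub_exp z ((j : ℕ) * (Real.pi / M))
  rw [← psk_eq_exp] at e
  refine lt_of_pow_lt_pow_left₀ 2 (norm_nonneg _) ?_
  have : 0 < 4 * Real.sin ((j : ℕ) * (Real.pi / M)) * (z.re * Real.sin ((j : ℕ) * (Real.pi / M))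
      - z.im * Real.cos ((j : ℕ) * (Real.pi / M))) := by
    have := sub_pos.2 h4
    positivity
  linarith

/-! ### The error probability of `M`-PSK in Gaussian noise -/

theorem integral_Ioi_mul_exp {s : ℝ} (hs : 0 < s) (ρ : ℝ) :
    ∫ r in Set.Ioi ρ, r * Real.exp (-(1 / s) * r ^ 2) = s / 2 * Real.exp (-(1 / s) * ρ ^ 2) := by
  have hb : 0 < 1 / s := by positivity
  have h := integral_Ioi_of_hasDerivAt_of_tendsto' (a := ρ)
    (f := fun r => -(s / 2) * Real.exp (-(1 / s) * r ^ 2))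
    (f' := fun r => r * Real.exp (-(1 / s) * r ^ 2)) (m := 0) (fun r _ => ?_)
    (integrable_mul_exp_neg_mul_sq hb).integrableOn ?_
  · rw [h]
    ring
  · have h1 : HasDerivAt (fun r : ℝ => -(1 / s) * r ^ 2) (-(1 / s) * (2 * r)) r := by
      simpa using (hasDerivAt_pow 2 r).const_mul (-(1 / s))
    exact (h1.exp.const_mul (-(s / 2))).congr_deriv (by field_simp)
  · have h2 : Filter.Tendsto (fun r : ℝ => -(1 / s) * r ^ 2) Filter.atTop Filter.atBot :=
      (Filter.tendsto_pow_atTop two_ne_zero).const_mul_atTop_of_neg (by linarith)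
    simpa using (Real.tendsto_exp_atBot.comp h2).const_mul (-(s / 2))

theorem sector_polar (A r φ : ℝ) :
    |r * Real.sin φ| * Real.cos A - (1 + r * Real.cos φ) * Real.sin A
      = |r| * (|Real.sin φ| * Real.cos A) - r * Real.cos φ * Real.sin A - Real.sin A := by
  rw [abs_mul]
  ring

theorem abs_sin_eq_sin_abs {φ : ℝ} (h : |φ| ≤ Real.pi) : |Real.sin φ| = Real.sin |φ| := by
  rcases abs_cases φ with ⟨h1, h2⟩ | ⟨h1, h2⟩
  · rw [h1] at h ⊢
    exact abs_of_nonneg (Real.sin_nonneg_of_nonneg_of_le_pi h2 h)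
  · rw [h1] at h ⊢
    rw [← abs_neg, ← Real.sin_neg]
    exact abs_of_nonneg (Real.sin_nonneg_of_nonneg_of_le_pi (by linarith) h)

/-- The radial part of the error probability in direction `φ`. -/
theorem integral_radial {s A : ℝ} (hs : 0 < s) (hA : 0 < Real.sin A) (hA0 : 0 < A) {T : Set ℂ}
    (hT1 : ∀ n : ℂ, (1 + n).re * Real.sin A < |(1 + n).im| * Real.cos A → n ∈ T)
    (hT2 : ∀ n ∈ T, (1 + n).re * Real.sin A ≤ |(1 + n).im| * Real.cos A)
    {φ : ℝ} (hφ : |φ| < Real.pi) (hAπ : A < Real.pi) :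
    ∫ r in Set.Ioi (0 : ℝ), T.indicator (fun _ => r * Real.exp (-(1 / s) * r ^ 2))
        (Complex.polarCoord.symm (r, φ))
      = (Set.Ioo A Real.pi).indicator
        (fun ψ => s / 2 * Real.exp (-(1 / s) * (Real.sin A / Real.sin (ψ - A)) ^ 2)) |φ| := by
  -- The boundary condition along the ray is affine in `r`. For `|φ| > A` it changes sign at `ρ =
  -- sin A / sin (|φ| - A)`; otherwise the ray never leaves the sector.
  have key : ∀ r : ℝ, 0 < r → |(1 + (Complex.polarCoord.symm (r, φ) : ℂ)).im| * Real.cos A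
      - (1 + (Complex.polarCoord.symm (r, φ) : ℂ)).re * Real.sin A
      = r * Real.sin (|φ| - A) - Real.sin A := by
    intro r hr
    have him : (1 + (Complex.polarCoord.symm (r, φ) : ℂ)).im = r * Real.sin φ := by
      rw [Complex.polarCoord_symm_apply]
      simp [-Complex.ofReal_cos, -Complex.ofReal_sin]
    have hre : (1 + (Complex.polarCoord.symm (r, φ) : ℂ)).re = 1 + r * Real.cos φ := by
      rw [Complex.polarCoord_symm_apply]
      simp [-Complex.ofReal_cos, -Complex.ofReal_sin]
    rw [him, hre, sector_polar, abs_of_pos hr, abs_sin_eq_sin_abs hφ.le, ← Real.cos_abs φ,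
      Real.sin_sub]
    ring
  by_cases hc : A < |φ|
  · have hsin : 0 < Real.sin (|φ| - A) :=
      Real.sin_pos_of_pos_of_lt_pi (by linarith) (by linarith)
    set ρ := Real.sin A / Real.sin (|φ| - A) with hρ
    have hρ0 : 0 < ρ := by positivity
    rw [Set.indicator_of_mem (by exact ⟨hc, hφ⟩), ← integral_Ioi_mul_exp hs,
      ← integral_indicator measurableSet_Ioi, ← integral_indicator measurableSet_Ioi]
    refine integral_congr_ae ?_
    -- Membership in `T` is undetermined on the boundary, which meets the ray in one null point.
    have hne : ∀ᵐ r : ℝ, r ≠ ρ := by simp [ae_iff]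
    filter_upwards [hne] with r hr
    by_cases hr0 : 0 < r
    · rw [Set.indicator_of_mem (show r ∈ Set.Ioi 0 from hr0)]
      have hk := key r hr0
      rcases lt_or_gt_of_ne hr with h | h
      · have hnT : (Complex.polarCoord.symm (r, φ) : ℂ) ∉ T := by
          intro hmem
          have := hT2 _ hmem
          rw [hρ, lt_div_iff₀ hsin] at h
          linarith
        rw [Set.indicator_of_notMem hnT,
          Set.indicator_of_notMem (show r ∉ Set.Ioi ρ from fun h' => h.not_gt h')]
      · rw [Set.indicator_of_mem (show r ∈ Set.Ioi ρ from h), Set.indicator_of_mem]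
        apply hT1
        rw [hρ, div_lt_iff₀ hsin] at h
        linarith
    · rw [Set.indicator_of_notMem (by simpa using hr0), Set.indicator_of_notMem]
      simp only [Set.mem_Ioi, not_lt]
      linarith
  · rw [Set.indicator_of_notMem (fun h => hc h.1)]
    refine setIntegral_eq_zero_of_forall_eq_zero fun r hr => ?_
    rw [Set.indicator_of_notMem]
    intro hmem
    have := hT2 _ hmem
    have hk := key r hr
    have : Real.sin (|φ| - A) ≤ 0 := by
      refine Real.sin_nonpos_of_nonpos_of_neg_pi_le (by linarith) ?_
      linarith [abs_nonneg φ]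
    have hr' : 0 < r := hr
    nlinarith

/-- Polar coordinates centred at the transmitted symbol make the radial integral elementary.
Symmetry in `φ` gives the factor 2, and the shift `θ = |φ| - π / M` gives the range up to `(M - 1) π
/ M`. Since `T` is pinned only off the sector's boundary, any treatment of ties is covered. -/
theorem measureReal_isoGauss_eq_condErrorProb {M : ℕ} (hM : 2 ≤ M) {s : ℝ} (hs : 0 < s)
    {T : Set ℂ} (hT : MeasurableSet T)
    (hT1 : ∀ n : ℂ, (1 + n).re * Real.sin (Real.pi / M)
      < |(1 + n).im| * Real.cos (Real.pi / M) → n ∈ T)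
    (hT2 : ∀ n ∈ T, (1 + n).re * Real.sin (Real.pi / M)
      ≤ |(1 + n).im| * Real.cos (Real.pi / M)) :
    (isoGauss ℂ s).real T = condErrorProb M (1 / s) := by
  have hA := sin_pi_div_pos hM
  have hM0 : (0 : ℝ) < M := by exact_mod_cast (by omega : 0 < M)
  have hA0 : 0 < Real.pi / M := by positivity
  have hAπ : Real.pi / M < Real.pi := by linarith [pi_div_le hM, Real.pi_pos]
  have hMπ : ((M : ℝ) - 1) / M * Real.pi = Real.pi - Real.pi / M := by field_simp
  rw [condErrorProb, hMπ]
  set A := Real.pi / M with hAdef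
  have e1 : (isoGauss ℂ s).real T = (Real.pi * s)⁻¹ *
      ∫ p in polarCoord.target, T.indicator
        (fun _ => p.1 * Real.exp (-(1 / s) * p.1 ^ 2)) (Complex.polarCoord.symm p) := by
    have := integral_isoGauss (V := ℂ) hs (T.indicator fun _ => (1 : ℝ))
    rw [integral_indicator_const _ hT, Complex.finrank_real_complex] at this
    simp only [smul_eq_mul, mul_one] at this
    rw [this, ← Complex.integral_comp_polarCoord_symm]
    congr 1
    · have : (0 : ℝ) < Real.pi * s := by positivity
      rw [Real.rpow_neg this.le]
      norm_num
    · refine setIntegral_congr_fun polarCoord.open_target.measurableSet fun p _ => ?_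
      simp only [Complex.norm_polarCoord_symm, sq_abs, smul_eq_mul]
      by_cases hp : (Complex.polarCoord.symm p : ℂ) ∈ T
      · rw [Set.indicator_of_mem hp, Set.indicator_of_mem hp, mul_one]
      · rw [Set.indicator_of_notMem hp, Set.indicator_of_notMem hp, mul_zero, mul_zero]
  have hmeas : Measurable fun p : ℝ × ℝ => T.indicator
      (fun _ => p.1 * Real.exp (-(1 / s) * p.1 ^ 2)) (Complex.polarCoord.symm p : ℂ) := by
    have hc : Measurable fun p : ℝ × ℝ => (Complex.polarCoord.symm p : ℂ) := by
      simp only [Complex.polarCoord_symm_apply]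
      fun_prop
    have : (fun p : ℝ × ℝ => T.indicator
        (fun _ => p.1 * Real.exp (-(1 / s) * p.1 ^ 2)) (Complex.polarCoord.symm p : ℂ))
        = ((fun p : ℝ × ℝ => (Complex.polarCoord.symm p : ℂ)) ⁻¹' T).indicator
          fun p => p.1 * Real.exp (-(1 / s) * p.1 ^ 2) := rfl
    rw [this]
    exact Measurable.indicator (by fun_prop) (hc hT)
  have hswap : ∫ p in polarCoord.target, T.indicator
        (fun _ => p.1 * Real.exp (-(1 / s) * p.1 ^ 2)) (Complex.polarCoord.symm p)
      = ∫ φ in Set.Ioo (-Real.pi) Real.pi, ∫ r in Set.Ioi (0 : ℝ), T.indicator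
        (fun _ => r * Real.exp (-(1 / s) * r ^ 2)) (Complex.polarCoord.symm (r, φ)) := by
    rw [polarCoord_target, Measure.volume_eq_prod, ← Measure.prod_restrict, integral_prod_symm]
    have hi : Integrable (fun r : ℝ => r * Real.exp (-(1 / s) * r ^ 2))
        (volume.restrict (Set.Ioi 0)) :=
      (integrable_mul_exp_neg_mul_sq (by positivity)).integrableOn
    have : IsFiniteMeasure (volume.restrict (Set.Ioo (-Real.pi) Real.pi)) := by
      constructor
      simp
    refine (hi.comp_fst (volume.restrict (Set.Ioo (-Real.pi) Real.pi))).mono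
      hmeas.aestronglyMeasurable (.of_forall fun p => ?_)
    exact norm_indicator_le_norm_self (fun _ => p.1 * Real.exp (-(1 / s) * p.1 ^ 2)) _
  have hang : ∫ φ in Set.Ioo (-Real.pi) Real.pi, ∫ r in Set.Ioi (0 : ℝ), T.indicator
        (fun _ => r * Real.exp (-(1 / s) * r ^ 2)) (Complex.polarCoord.symm (r, φ))
      = 2 * ∫ ψ in A..Real.pi,
        s / 2 * Real.exp (-(1 / s) * (Real.sin A / Real.sin (ψ - A)) ^ 2) := by
    rw [setIntegral_congr_fun measurableSet_Ioo fun φ hφ =>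
      integral_radial hs hA hA0 hT1 hT2 (abs_lt.2 hφ) hAπ, ← integral_indicator measurableSet_Ioo]
    have : ∀ φ : ℝ, (Set.Ioo (-Real.pi) Real.pi).indicator (fun φ => (Set.Ioo A Real.pi).indicator
        (fun ψ => s / 2 * Real.exp (-(1 / s) * (Real.sin A / Real.sin (ψ - A)) ^ 2)) |φ|) φ
        = (Set.Ioo A Real.pi).indicator
        (fun ψ => s / 2 * Real.exp (-(1 / s) * (Real.sin A / Real.sin (ψ - A)) ^ 2)) |φ| := by
      intro φ
      by_cases hφ : |φ| < Real.pi
      · rw [Set.indicator_of_mem]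
        exact abs_lt.1 hφ
      · rw [Set.indicator_of_notMem, Set.indicator_of_notMem]
        · exact fun h => hφ h.2
        · exact fun h => hφ (abs_lt.2 h)
    simp_rw [this]
    rw [integral_comp_abs (f := (Set.Ioo A Real.pi).indicator
        (fun ψ => s / 2 * Real.exp (-(1 / s) * (Real.sin A / Real.sin (ψ - A)) ^ 2))),
      setIntegral_indicator measurableSet_Ioo, Set.inter_eq_self_of_subset_right
        (show Set.Ioo A Real.pi ⊆ Set.Ioi 0 from fun x hx => hA0.trans hx.1),
      intervalIntegral.integral_of_le hAπ.le,
      integral_Ioc_eq_integral_Ioo]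
  rw [e1, hswap, hang, intervalIntegral.integral_const_mul,
    intervalIntegral.integral_comp_sub_right
      (fun θ => Real.exp (-(1 / s) * (Real.sin A / Real.sin θ) ^ 2)), sub_self]
  simp_rw [div_pow]
  field_simp

/-! ### The law of the channel matrix -/

/-- The rows are conjugate transposes of the Gaussian vectors; conjugation does not change a real
part, so the unconjugated pairing with a row reproduces the form with `R` itself. -/
theorem matGauss_of_rows {Ω : Type*} [MeasurableSpace Ω] {P : Measure Ω} {n k : ℕ}
    {R : Matrix (Fin k) (Fin k) ℂ} {G : Ω → Fin n → Fin k → ℂ} (hG : Measurable G)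
    (hrows : ∀ i, IsCN P (fun ω => star (G ω i)) 0 R)
    (hind : iIndepFun (fun (i : Fin n) (ω : Ω) => G ω i) P) : MatGauss (P.map G) 0 R := by
  intro T
  have hc : Continuous fun G : Fin n → Fin k → ℂ =>
      Complex.exp (Complex.I * ((∑ i, T i ⬝ᵥ G i).re : ℂ)) := by fun_prop
  rw [integral_map hG.aemeasurable hc.aestronglyMeasurable]
  have e1 : ∀ ω, Complex.exp (Complex.I * ((∑ i, T i ⬝ᵥ G ω i).re : ℂ))
      = ∏ i, Complex.exp (Complex.I * ((T i ⬝ᵥ G ω i).re : ℂ)) := by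
    intro ω
    rw [← Complex.exp_sum, Complex.re_sum, Complex.ofReal_sum, Finset.mul_sum]
  simp_rw [e1]
  rw [hind.integral_fun_prod_comp
    (f := fun i x => Complex.exp (Complex.I * ((T i ⬝ᵥ x).re : ℂ)))
    (fun i => ((measurable_pi_apply i).comp hG).aemeasurable) (fun i => by fun_prop)]
  have e2 : ∀ i, ∫ ω, Complex.exp (Complex.I * ((T i ⬝ᵥ G ω i).re : ℂ)) ∂P
      = Complex.exp (-(star (T i) ⬝ᵥ (R *ᵥ T i)) / 4) := by
    intro i
    have h := (hrows i).2 (T i)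
    have e3 : ∀ ω, (star (T i) ⬝ᵥ star (G ω i)).re = (T i ⬝ᵥ G ω i).re := by
      intro ω
      rw [Matrix.star_dotProduct_star, dotProduct_comm]
      simp
    simp only [e3, dotProduct_zero, Complex.zero_re, Complex.ofReal_zero, mul_zero, zero_sub] at h
    rw [h, neg_div]
  rw [Finset.prod_congr rfl fun i _ => e2 i, ← Complex.exp_sum]
  congr 1
  simp only [Pi.zero_apply, dotProduct_zero, Finset.sum_const_zero, Complex.zero_re,
    Complex.ofReal_zero, mul_zero, zero_sub, neg_div, Finset.sum_neg_distrib, Finset.sum_div]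

theorem MatGauss.map_affine {n k : ℕ} {ν : Measure (Fin n → Fin k → ℂ)}
    {R : Matrix (Fin k) (Fin k) ℂ} (h : MatGauss ν 0 R) (m : Fin n → Fin k → ℂ) (c : ℝ) :
    MatGauss (ν.map fun G => m + (c : ℂ) • G) m (((c ^ 2 : ℝ) : ℂ) • R) := by
  intro T
  have hc : Continuous fun G : Fin n → Fin k → ℂ =>
      Complex.exp (Complex.I * ((∑ i, T i ⬝ᵥ G i).re : ℂ)) := by fun_prop
  rw [integral_map (by fun_prop) hc.aestronglyMeasurable]
  have e : ∀ G : Fin n → Fin k → ℂ, Complex.exp (Complex.I * ((∑ i, T i ⬝ᵥ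
        (m + (c : ℂ) • G) i).re : ℂ))
      = Complex.exp (Complex.I * ((∑ i, T i ⬝ᵥ m i).re : ℂ))
        * Complex.exp (Complex.I * ((∑ i, ((c : ℂ) • T) i ⬝ᵥ G i).re : ℂ)) := by
    intro G
    rw [← Complex.exp_add]
    congr 1
    simp only [Pi.add_apply, Pi.smul_apply, dotProduct_add, dotProduct_smul, smul_dotProduct,
      Finset.sum_add_distrib, Complex.add_re, Complex.ofReal_add]
    ring
  simp_rw [e]
  rw [integral_const_mul, h, ← Complex.exp_add]
  congr 1
  have e2 : ∀ i, star (((c : ℂ) • T) i) ⬝ᵥ (R *ᵥ ((c : ℂ) • T) i)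
      = star (T i) ⬝ᵥ ((((c ^ 2 : ℝ) : ℂ) • R) *ᵥ T i) := by
    intro i
    simp only [Pi.smul_apply, star_smul, Matrix.mulVec_smul, Matrix.smul_mulVec, smul_dotProduct,
      dotProduct_smul, smul_eq_mul, RCLike.star_def, Complex.conj_ofReal]
    push_cast
    ring
  simp only [e2, Pi.zero_apply, dotProduct_zero, Finset.sum_const_zero, Complex.zero_re,
    Complex.ofReal_zero, mul_zero, zero_sub]
  ring

theorem VecGauss.of_isCN {Ω : Type*} [MeasurableSpace Ω] {P : Measure Ω} {n : ℕ} {s : ℝ}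
    {v : Ω → Fin n → ℂ} (hv : IsCN P v 0 ((s : ℂ) • (1 : Matrix (Fin n) (Fin n) ℂ))) :
    VecGauss (P.map v) 0 s := by
  intro t
  have hc : Continuous fun x : Fin n → ℂ => Complex.exp (Complex.I * ((t ⬝ᵥ x).re : ℂ)) := by
    fun_prop
  rw [integral_map hv.1.aemeasurable hc.aestronglyMeasurable]
  have h := hv.2 (star t)
  simp only [star_star] at h
  rw [h]
  congr 2
  rw [Matrix.smul_mulVec, Matrix.one_mulVec, dotProduct_smul, smul_eq_mul, Complex.ofReal_mul,
    mul_div_assoc]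
  congr 1
  rw [Complex.ofReal_sum, dotProduct, Finset.sum_div]
  refine Finset.sum_congr rfl fun i _ => ?_
  rw [Pi.star_apply, RCLike.star_def, Complex.mul_conj, Complex.normSq_eq_norm_sq]
  push_cast
  rfl

/-! ### The error probability given the channel and the symbols -/

/-- Outputs for which some symbol is strictly closer than the symbol `j`. -/
def strictErr (M : ℕ) (j : Fin M) : Set ℂ := {z | ∃ i, ‖z - psk M i‖ < ‖z - psk M j‖}

/-- Outputs for which some other symbol is at least as close as the symbol `j`. -/
def weakErr (M : ℕ) (j : Fin M) : Set ℂ := {z | ∃ i, i ≠ j ∧ ‖z - psk M i‖ ≤ ‖z - psk M j‖}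

theorem measurableSet_strictErr (M : ℕ) (j : Fin M) : MeasurableSet (strictErr M j) := by
  rw [strictErr, Set.ofPred_exists]
  exact .iUnion fun i => measurableSet_lt (by fun_prop) (by fun_prop)

theorem measurableSet_weakErr (M : ℕ) (j : Fin M) : MeasurableSet (weakErr M j) := by
  rw [weakErr, Set.ofPred_exists]
  exact .iUnion fun i => (MeasurableSet.const _).inter (measurableSet_le
    (f := fun z : ℂ => ‖z - psk M i‖) (g := fun z : ℂ => ‖z - psk M j‖) (by fun_prop) (by fun_prop))

theorem strictErr_subset_weakErr (M : ℕ) (j : Fin M) : strictErr M j ⊆ weakErr M j := by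
  rintro z ⟨i, hi⟩
  exact ⟨i, fun h => by rw [h] at hi; exact lt_irrefl _ hi, hi.le⟩

theorem psk_add {M : ℕ} [NeZero M] (i j : Fin M) : psk M (i + j) = psk M i * psk M j := by
  have hM : (M : ℂ) ≠ 0 := by exact_mod_cast NeZero.ne M
  rw [psk, psk, psk, ← Complex.exp_add, Complex.exp_eq_exp_iff_exists_int]
  obtain ⟨q, hq⟩ : ∃ q : ℕ, (i + j : ℕ) % M + M * q = i + j := ⟨_, Nat.mod_add_div _ _⟩
  -- Addition in `Fin M` wraps around `q` times, costing `q` full turns.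
  refine ⟨-(q : ℤ), ?_⟩
  have h' : (((i + j : Fin M) : ℕ) : ℂ) = (i : ℕ) + (j : ℕ) - M * (q : ℂ) := by
    rw [Fin.val_add, eq_sub_iff_add_eq]
    exact_mod_cast hq
  rw [h']
  push_cast
  field_simp
  ring

theorem psk_zero (M : ℕ) [NeZero M] : psk M 0 = 1 := by simp [psk]

theorem norm_rotate_sub {M : ℕ} [NeZero M] (z : ℂ) (i j : Fin M) :
    ‖psk M j * z - psk M (j + i)‖ = ‖z - psk M i‖ := by
  rw [psk_add, ← mul_sub, norm_mul, norm_psk, one_mul]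

/-- Error probability for `PSK` symbol `j` in additive circular Gaussian noise. -/
theorem isoGauss_rotated_error {M : ℕ} (hM : 2 ≤ M) {s : ℝ} (hs : 0 < s) (j : Fin M) {S : Set ℂ}
    (hS : MeasurableSet S) (hS1 : strictErr M j ⊆ S) (hS2 : S ⊆ weakErr M j) :
    (isoGauss ℂ s).real {n | psk M j * (1 + n) ∈ S} = condErrorProb M (1 / s) := by
  have : NeZero M := ⟨by omega⟩
  refine measureReal_isoGauss_eq_condErrorProb hM hs ?_ ?_ ?_
  · exact (by fun_prop : Measurable fun n : ℂ => psk M j * (1 + n)) hS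
  · intro n hn
    by_contra hmem
    refine hn.not_ge (sector_of_forall_le hM fun i => ?_)
    have h1 : psk M j * (1 + n) ∉ strictErr M j := fun h => hmem (hS1 h)
    simp only [strictErr, Set.mem_ofPred_eq, not_exists, not_lt] at h1
    have h2 := h1 (j + i)
    rw [norm_rotate_sub] at h2
    have h3 := norm_rotate_sub (1 + n) 0 j
    rw [add_zero, psk_zero] at h3
    rwa [h3] at h2
  · intro n hn
    by_contra hlt
    obtain ⟨i, hi, hle⟩ := hS2 hn
    have h1 := norm_rotate_sub (1 + n) (i - j) j
    rw [add_sub_cancel] at h1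
    have h3 := norm_rotate_sub (1 + n) 0 j
    rw [add_zero, psk_zero] at h3
    rw [h1, h3] at hle
    refine hle.not_gt (lt_of_mem_sector hM (not_le.1 hlt) ?_)
    intro h0
    exact hi (sub_eq_zero.1 (Fin.ext h0))

/-- The pseudo-inverse is a left inverse of `H`, so interference cancels exactly and only a linear
form in the noise remains. -/
theorem zfOutput_received {n k : ℕ} {Es : ℝ} (hEs : 0 < Es) {H : Matrix (Fin n) (Fin (k + 1)) ℂ}
    (hH : ColIndep H) (x : Fin (k + 1) → ℂ) (v : Fin n → ℂ) :
    zfOutput Es H (received Es H x v) 0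
      = x 0 + (((Real.sqrt (((k + 1 : ℕ) : ℝ) / Es) : ℝ) : ℂ)
        • ((Hᴴ * H)⁻¹ * Hᴴ) 0) ⬝ᵥ v := by
  have hdet := isUnit_det_gram hH
  have h1 : Real.sqrt (((k + 1 : ℕ) : ℝ) / Es) * Real.sqrt (Es / ((k + 1 : ℕ) : ℝ)) = 1 := by
    rw [← Real.sqrt_mul (by positivity)]
    have : ((k + 1 : ℕ) : ℝ) ≠ 0 := by positivity
    have h : ((k + 1 : ℕ) : ℝ) / Es * (Es / ((k + 1 : ℕ) : ℝ)) = 1 := by field_simp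
    rw [h, Real.sqrt_one]
  have h1' : ((Real.sqrt (((k + 1 : ℕ) : ℝ) / Es) : ℝ) : ℂ)
      * ((Real.sqrt (Es / ((k + 1 : ℕ) : ℝ)) : ℝ) : ℂ) = 1 := by exact_mod_cast h1
  have h2 : ((Hᴴ * H)⁻¹ * Hᴴ) *ᵥ (H *ᵥ x) = x := by
    rw [Matrix.mulVec_mulVec, Matrix.mul_assoc, Matrix.nonsing_inv_mul _ hdet, Matrix.one_mulVec]
  rw [zfOutput, received, Matrix.mulVec_add, Matrix.mulVec_smul, h2, smul_add, smul_smul, h1',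
    one_smul, smul_dotProduct]
  rfl

/-- For the pseudo-inverse `B` one has `B * Bᴴ = (Hᴴ * H)⁻¹`; this diagonal entry is the noise
amplification of Stream 1. -/
theorem sum_norm_sq_zf_row {n k : ℕ} {H : Matrix (Fin n) (Fin (k + 1)) ℂ} (hH : ColIndep H) :
    ∑ i, ‖((Hᴴ * H)⁻¹ * Hᴴ) 0 i‖ ^ 2 = ((Hᴴ * H)⁻¹ 0 0).re := by
  have hdet := isUnit_det_gram hH
  set B := (Hᴴ * H)⁻¹ * Hᴴ with hB
  have hherm : ((Hᴴ * H)⁻¹)ᴴ = (Hᴴ * H)⁻¹ := (Matrix.isHermitian_conjTranspose_mul_self H).inv.eq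
  have h1 : B * Bᴴ = (Hᴴ * H)⁻¹ := by
    rw [hB, Matrix.conjTranspose_mul, Matrix.conjTranspose_conjTranspose, hherm, Matrix.mul_assoc,
      ← Matrix.mul_assoc Hᴴ, Matrix.mul_nonsing_inv _ hdet, Matrix.mul_one]
  rw [← h1, Matrix.mul_apply, Complex.re_sum]
  refine Finset.sum_congr rfl fun i _ => ?_
  rw [Matrix.conjTranspose_apply, RCLike.star_def, Complex.mul_conj, Complex.normSq_eq_norm_sq,
    Complex.ofReal_re]

/-- Dividing by the unit-modulus symbol turns the output into `1 + z`, with `z` circular Gaussian of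
variance exactly the reciprocal of the SNR. -/
theorem condErrorProb_given {n k M : ℕ} (hM : 2 ≤ M) {Es N0 : ℝ} (hEs : 0 < Es) (hN0 : 0 < N0)
    {μ : Measure (Fin n → ℂ)} [IsProbabilityMeasure μ] (hμ : VecGauss μ 0 N0)
    {H : Matrix (Fin n) (Fin (k + 1)) ℂ} (hH : ColIndep H) (x : Fin (k + 1) → Fin M) {S : Set ℂ}
    (hS : MeasurableSet S) (hS1 : strictErr M (x 0) ⊆ S) (hS2 : S ⊆ weakErr M (x 0)) :
    μ.real {v | zfOutput Es H (received Es H (fun l => psk M (x l)) v) 0 ∈ S}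
      = condErrorProb M (snr (gammaS Es N0 (k + 1)) H) := by
  set w : Fin n → ℂ := ((Real.sqrt (((k + 1 : ℕ) : ℝ) / Es) : ℝ) : ℂ)
    • ((Hᴴ * H)⁻¹ * Hᴴ) 0 with hw
  set p := psk M (x 0) with hp
  have hp0 : p ≠ 0 := by rw [← norm_ne_zero_iff, hp, norm_psk]; exact one_ne_zero
  set b : Fin n → ℂ := p⁻¹ • w with hb
  have hg : 0 < ((Hᴴ * H)⁻¹ 0 0).re :=
    (PosDef.exists_inv_zero_zero (Matrix.PosDef.conjTranspose_mul_self H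
      (Matrix.mulVec_injective_iff.2 hH))).1
  have hbn : ∑ i, ‖b i‖ ^ 2 = ((k + 1 : ℕ) : ℝ) / Es * ((Hᴴ * H)⁻¹ 0 0).re := by
    rw [← sum_norm_sq_zf_row hH, Finset.mul_sum]
    refine Finset.sum_congr rfl fun i _ => ?_
    rw [hb, hw, Pi.smul_apply, Pi.smul_apply, norm_smul, norm_smul, norm_inv, hp, norm_psk,
      inv_one, one_mul, mul_pow, Complex.norm_real, Real.norm_eq_abs, sq_abs,
      Real.sq_sqrt (by positivity)]
  have hb0 : b ≠ 0 := by
    intro h0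
    have : 0 < ∑ i, ‖b i‖ ^ 2 := by rw [hbn]; positivity
    simp [h0] at this
  have hs : 0 < N0 * ∑ i, ‖b i‖ ^ 2 := by rw [hbn]; positivity
  have hset : {v | zfOutput Es H (received Es H (fun l => psk M (x l)) v) 0 ∈ S}
      = (fun v => b ⬝ᵥ v) ⁻¹' {z | psk M (x 0) * (1 + z) ∈ S} := by
    ext v
    simp only [Set.mem_ofPred_eq, Set.mem_preimage]
    have hbv : b ⬝ᵥ v = p⁻¹ * (w ⬝ᵥ v) := by rw [hb, smul_dotProduct, smul_eq_mul]
    rw [zfOutput_received hEs hH, ← hp, ← hw, hbv, mul_add, mul_one, mul_inv_cancel_left₀ hp0]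
  have hbm : Measurable fun v : Fin n → ℂ => b ⬝ᵥ v :=
    (by fun_prop : Continuous fun v : Fin n → ℂ => b ⬝ᵥ v).measurable
  have hTm : MeasurableSet {z | psk M (x 0) * (1 + z) ∈ S} :=
    (by fun_prop : Measurable fun n : ℂ => psk M (x 0) * (1 + n)) hS
  rw [hset, ← map_measureReal_apply hbm hTm, hμ.map_dotProduct hN0 hb0,
    isoGauss_rotated_error hM hs (x 0) hS hS1 hS2, hbn, snr, gammaS]
  congr 1
  field_simp

theorem measurable_zfOutput {n k : ℕ} (M : ℕ) (Es : ℝ) :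
    Measurable fun q : ((Fin n → Fin (k + 1) → ℂ) × (Fin n → ℂ)) × (Fin (k + 1) → Fin M) =>
      zfOutput Es (Matrix.of q.1.1) (received Es (Matrix.of q.1.1) (fun l => psk M (q.2 l)) q.1.2)
        0 := by
  have h1 : ∀ i j, Measurable
      fun q : ((Fin n → Fin (k + 1) → ℂ) × (Fin n → ℂ)) × (Fin (k + 1) → Fin M) =>
      ((Matrix.of q.1.1)ᴴ * Matrix.of q.1.1)⁻¹ i j := fun i j =>
    (measurable_gram_inv i j).comp (g := fun G : Fin n → Fin (k + 1) → ℂ =>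
      ((Matrix.of G)ᴴ * Matrix.of G)⁻¹ i j) 
      (f := fun q : ((Fin n → Fin (k + 1) → ℂ) × (Fin n → ℂ)) × (Fin (k + 1) → Fin M) => q.1.1)
      (measurable_fst.comp measurable_fst)
  have h2 : ∀ l, Measurable
      fun q : ((Fin n → Fin (k + 1) → ℂ) × (Fin n → ℂ)) × (Fin (k + 1) → Fin M) =>
      psk M (q.2 l) := fun l =>
    (measurable_from_top (f := psk M)).comp ((measurable_pi_apply l).comp measurable_snd)
  have h3 : ∀ i j, Measurable
      fun q : ((Fin n → Fin (k + 1) → ℂ) × (Fin n → ℂ)) × (Fin (k + 1) → Fin M) =>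
      q.1.1 i j := by
    intro i j
    fun_prop
  simp only [zfOutput, received, Pi.smul_apply, Matrix.mulVec, dotProduct, Matrix.mul_apply,
    Pi.add_apply, Matrix.conjTranspose_apply, Matrix.of_apply, smul_eq_mul] at h1 ⊢
  refine Measurable.const_mul (Finset.measurable_sum _ fun i _ => Measurable.mul
    (Finset.measurable_sum _ fun j _ => (h1 0 j).mul (continuous_star.measurable.comp (h3 i j)))
    (Measurable.add (Measurable.const_mul (Finset.measurable_sum _ fun l _ => (h3 i l).mul (h2 l)) _) ?_)) _
  fun_prop

/-- Error probability averaged over channel, noise and symbols, for error regions differing only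
in the treatment of ties. -/
theorem measureReal_error_region {Ω : Type*} [MeasurableSpace Ω] {P : Measure Ω}
    [IsProbabilityMeasure P] {n k M : ℕ} (hM : 2 ≤ M) {Es N0 : ℝ} (hEs : 0 < Es) (hN0 : 0 < N0)
    {G : Ω → Fin n → Fin (k + 1) → ℂ} (hG : Measurable G) {v : Ω → Fin n → ℂ} (hv : Measurable v)
    (hvG : VecGauss (P.map v) 0 N0) {sym : Ω → Fin (k + 1) → Fin M} (hsym : Measurable sym)
    (hGv : IndepFun G v P) (hGvs : IndepFun (fun ω => (G ω, v ω)) sym P)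
    (hcol : ∀ᵐ H ∂(P.map G), ColIndep H) {S : Fin M → Set ℂ} (hS : ∀ j, MeasurableSet (S j))
    (hS1 : ∀ j, strictErr M j ⊆ S j) (hS2 : ∀ j, S j ⊆ weakErr M j) :
    P.real {ω | zfOutput Es (Matrix.of (G ω)) (received Es (Matrix.of (G ω))
        (fun l => psk M (sym ω l)) (v ω)) 0 ∈ S (sym ω 0)}
      = ∫ H, condErrorProb M (snr (gammaS Es N0 (k + 1)) (Matrix.of H)) ∂(P.map G) := by
  have pG := Measure.isProbabilityMeasure_map (μ := P) hG.aemeasurable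
  have pv := Measure.isProbabilityMeasure_map (μ := P) hv.aemeasurable
  have ps := Measure.isProbabilityMeasure_map (μ := P) hsym.aemeasurable
  set E : Set (((Fin n → Fin (k + 1) → ℂ) × (Fin n → ℂ)) × (Fin (k + 1) → Fin M)) :=
    {q | zfOutput Es (Matrix.of q.1.1) (received Es (Matrix.of q.1.1)
        (fun l => psk M (q.2 l)) q.1.2) 0 ∈ S (q.2 0)} with hE
  have hEm : MeasurableSet E := by
    have : E = ⋃ j, {q | q.2 0 = j} ∩ {q | zfOutput Es (Matrix.of q.1.1)
        (received Es (Matrix.of q.1.1) (fun l => psk M (q.2 l)) q.1.2) 0 ∈ S j} := by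
      ext q
      simp [hE]
    rw [this]
    refine .iUnion fun j => .inter ?_ (measurable_zfOutput M Es (hS j))
    have hq : Measurable fun q : ((Fin n → Fin (k + 1) → ℂ) × (Fin n → ℂ)) ×
        (Fin (k + 1) → Fin M) => q.2 0 := (measurable_pi_apply 0).comp measurable_snd
    exact hq (measurableSet_singleton j)
  have hlaw : P.map (fun ω => ((G ω, v ω), sym ω))
      = ((P.map G).prod (P.map v)).prod (P.map sym) := by
    rw [(indepFun_iff_map_prod_eq_prod_map_map (hG.prodMk hv).aemeasurable
      hsym.aemeasurable).1 hGvs, (indepFun_iff_map_prod_eq_prod_map_map hG.aemeasurable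
      hv.aemeasurable).1 hGv]
  have h1 : P.real {ω | zfOutput Es (Matrix.of (G ω)) (received Es (Matrix.of (G ω))
        (fun l => psk M (sym ω l)) (v ω)) 0 ∈ S (sym ω 0)}
      = (((P.map G).prod (P.map v)).prod (P.map sym)).real E := by
    rw [← hlaw, map_measureReal_apply ((hG.prodMk hv).prodMk hsym) hEm]
    rfl
  have h0 : (((P.map G).prod (P.map v)).prod (P.map sym)).real E
      = ∫ q, E.indicator (fun _ => (1 : ℝ)) q ∂(((P.map G).prod (P.map v)).prod (P.map sym)) := by
    rw [integral_indicator_const _ hEm, smul_eq_mul, mul_one]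
  rw [h1, h0, integral_prod_symm]
  swap
  · exact (integrable_const (1 : ℝ)).indicator hEm
  -- For each fixed symbol vector the value is the same by rotational symmetry, so averaging over
  -- the symbols is trivial.
  have h2 : ∀ x : Fin (k + 1) → Fin M,
      ∫ q, E.indicator (fun _ => (1 : ℝ)) (q, x) ∂((P.map G).prod (P.map v))
        = ∫ H, condErrorProb M (snr (gammaS Es N0 (k + 1)) (Matrix.of H)) ∂(P.map G) := by
    intro x
    have hEx : MeasurableSet {q | (q, x) ∈ E} := measurable_prodMk_right hEm
    have e1 : (fun q => E.indicator (fun _ => (1 : ℝ)) (q, x))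
        = {q | (q, x) ∈ E}.indicator (fun _ => (1 : ℝ)) := rfl
    rw [e1, integral_prod _ ((integrable_const (1 : ℝ)).indicator hEx)]
    refine integral_congr_ae ?_
    filter_upwards [hcol] with H hH
    have hEH : MeasurableSet {u | ((H, u), x) ∈ E} := measurable_prodMk_left hEx
    have e2 : (fun u => {q | (q, x) ∈ E}.indicator (fun _ => (1 : ℝ)) (H, u))
        = {u | ((H, u), x) ∈ E}.indicator (fun _ => (1 : ℝ)) := rfl
    rw [e2, integral_indicator_const _ hEH, smul_eq_mul, mul_one]
    exact condErrorProb_given hM hEs hN0 hvG (H := Matrix.of H) hH x (hS _) (hS1 _) (hS2 _)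
  simp_rw [h2]
  simp

/-- The detector's tie-breaking may be arbitrary, even non-measurable. Its error event lies between
the strict and weak error events, which are measurable and equally probable, and monotonicity of the
measure suffices. -/
theorem errorProb_eq_integral {Ω : Type*} [MeasurableSpace Ω] {P : Measure Ω}
    [IsProbabilityMeasure P] {n k M : ℕ} (hM : 2 ≤ M) {Es N0 : ℝ} (hEs : 0 < Es) (hN0 : 0 < N0)
    {G : Ω → Fin n → Fin (k + 1) → ℂ} (hG : Measurable G) {v : Ω → Fin n → ℂ} (hv : Measurable v)
    (hvG : VecGauss (P.map v) 0 N0) {sym : Ω → Fin (k + 1) → Fin M} (hsym : Measurable sym)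
    (hGv : IndepFun G v P) (hGvs : IndepFun (fun ω => (G ω, v ω)) sym P)
    (hcol : ∀ᵐ H ∂(P.map G), ColIndep H) {D : ℂ → Fin M} (hD : IsNearestSymbolDetector M D) :
    errorProb P Es D (fun ω => Matrix.of (G ω)) sym v
      = ∫ H, condErrorProb M (snr (gammaS Es N0 (k + 1)) (Matrix.of H)) ∂(P.map G) := by
  have h1 := measureReal_error_region hM hEs hN0 hG hv hvG hsym hGv hGvs hcol
    (measurableSet_strictErr M) (fun _ => subset_rfl) (strictErr_subset_weakErr M)
  have h2 := measureReal_error_region hM hEs hN0 hG hv hvG hsym hGv hGvs hcol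
    (measurableSet_weakErr M) (strictErr_subset_weakErr M) (fun _ => subset_rfl)
  refine le_antisymm ?_ ?_
  · rw [← h2, errorProb]
    exact measureReal_mono fun ω hω => ⟨_, hω, hD _ _⟩
  · rw [← h1, errorProb]
    refine measureReal_mono fun ω hω => ?_
    obtain ⟨i, hi⟩ := hω
    intro heq
    have := hD (zfOutput Es (Matrix.of (G ω)) (received Es (Matrix.of (G ω))
      (fun l => psk M (sym ω l)) (v ω)) 0) i
    rw [heq] at this
    exact this.not_gt hi

/-! ### Averaging over the SNR -/

/-- Nonnegativity of `γ` bounds the integrand by 1 on a finite measure space, which justifies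
Fubini. -/
theorem integral_condErrorProb {Ω : Type*} [MeasurableSpace Ω] {P : Measure Ω}
    [IsProbabilityMeasure P] (M : ℕ) {γ : Ω → ℝ} (hγ : Measurable γ) (hγ0 : ∀ ω, 0 ≤ γ ω) :
    ∫ ω, condErrorProb M (γ ω) ∂P
      = 1 / Real.pi * ∫ θ in (0 : ℝ)..(((M : ℝ) - 1) / (M : ℝ) * Real.pi),
        mgf γ P (-(Real.sin (Real.pi / (M : ℝ)) ^ 2 / Real.sin θ ^ 2)) := by
  simp only [condErrorProb]
  rw [integral_const_mul, ← intervalIntegral_integral_swap]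
  · simp only [mgf]
    congr 1
    refine intervalIntegral.integral_congr fun θ _ => integral_congr_ae (.of_forall fun ω => ?_)
    simp only
    congr 1
    ring
  · have hfin : IsFiniteMeasure (volume.restrict
        (Set.uIoc (0 : ℝ) (((M : ℝ) - 1) / (M : ℝ) * Real.pi))) := by
      constructor
      rw [Measure.restrict_apply_univ]
      exact measure_Ioc_lt_top
    refine (integrable_const (1 : ℝ)).mono' (Measurable.aestronglyMeasurable ?_)
      (.of_forall fun p => ?_)
    · have h1 : Measurable fun p : ℝ × Ω => γ p.2 := hγ.comp measurable_snd
      simp only [Function.uncurry_def]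
      fun_prop
    · simp only [Function.uncurry_def]
      rw [Real.norm_eq_abs, abs_of_pos (Real.exp_pos _), Real.exp_le_one_iff, neg_mul,
        Left.neg_nonpos_iff]
      have := hγ0 p.2
      positivity

theorem measurable_condErrorProb (M : ℕ) : Measurable (condErrorProb M) := by
  have h : StronglyMeasurable fun p : ℝ × ℝ =>
      Real.exp (-p.1 * (Real.sin (Real.pi / (M : ℝ)) ^ 2 / Real.sin p.2 ^ 2)) :=
    Measurable.stronglyMeasurable (by fun_prop)
  unfold condErrorProb intervalIntegral
  exact ((h.integral_prod_right.measurable.sub h.integral_prod_right.measurable).const_mul _)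

theorem sin_pos_of_mem_Ioc {M : ℕ} (hM : 2 ≤ M) {θ : ℝ}
    (hθ : θ ∈ Set.Ioc (0 : ℝ) (((M : ℝ) - 1) / (M : ℝ) * Real.pi)) : 0 < Real.sin θ := by
  have hM0 : (0 : ℝ) < M := by exact_mod_cast (by omega : 0 < M)
  refine Real.sin_pos_of_pos_of_lt_pi hθ.1 (hθ.2.trans_lt ?_)
  have : ((M : ℝ) - 1) / M < 1 := by
    rw [div_lt_one hM0]
    linarith
  nlinarith [Real.pi_pos]

theorem upper_limit_nonneg {M : ℕ} (hM : 2 ≤ M) :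
    0 ≤ ((M : ℝ) - 1) / (M : ℝ) * Real.pi := by
  have h2 : (2 : ℝ) ≤ M := by exact_mod_cast hM
  have : 0 ≤ (M : ℝ) - 1 := by linarith
  positivity

/-- Discards the endpoint `θ = 0`, where division by `sin θ ^ 2` takes a default value and pointwise
identities may fail. -/
theorem integral_congr_of_sin_pos {M : ℕ} (hM : 2 ≤ M) {f g : ℝ → ℝ}
    (h : ∀ θ, 0 < Real.sin θ → f θ = g θ) :
    ∫ θ in (0 : ℝ)..(((M : ℝ) - 1) / (M : ℝ) * Real.pi), f θ
      = ∫ θ in (0 : ℝ)..(((M : ℝ) - 1) / (M : ℝ) * Real.pi), g θ := by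
  rw [intervalIntegral.integral_of_le (upper_limit_nonneg hM),
    intervalIntegral.integral_of_le (upper_limit_nonneg hM)]
  exact setIntegral_congr_fun measurableSet_Ioc fun θ hθ => h θ (sin_pos_of_mem_Ioc hM hθ)

theorem MatGauss.integral_exp_neg_snr {n k : ℕ} (hk : k ≤ n)
    {ν : Measure (Fin n → Fin (k + 1) → ℂ)} [IsProbabilityMeasure ν] {m : Fin n → Fin (k + 1) → ℂ}
    {R : Matrix (Fin (k + 1)) (Fin (k + 1)) ℂ} (hR : R.PosDef) (h : MatGauss ν m R)
    {Γ S q : ℝ} (hΓ : 0 < Γ) (hS : 0 < S) (hq : 0 < q) :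
    ∫ H, Real.exp (-(S / q) * snr Γ (Matrix.of H)) ∂ν
      = (q / (q + gamma1 Γ R * S)) ^ (n - k) * ∫ H, Real.exp (-(Γ * S / (q + gamma1 Γ R * S)
          * snr 1 (consCol (ZF.muVec (Matrix.of m) R) H))) ∂(ν.map ZF.tailCols) := by
  have hρ := (PosDef.exists_inv_zero_zero hR).1
  have h1 := h.integral_exp_snr hk hR (c := Γ * S / q) (by positivity)
  have hden : 0 < q + gamma1 Γ R * S := by rw [gamma1]; positivity
  have e1 : 1 + Γ * S / q * ((R⁻¹ 0 0).re)⁻¹ = (q + gamma1 Γ R * S) / q := by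
    rw [gamma1]
    field_simp
  rw [e1] at h1
  have e2 : ∀ H : Matrix (Fin n) (Fin (k + 1)) ℂ,
      -(S / q) * snr Γ H = -(Γ * S / q) * snr 1 H := by
    intro H
    rw [snr_eq_mul]
    ring
  simp_rw [e2]
  rw [h1, ← inv_pow, inv_div]
  congr 1
  refine integral_congr_ae (.of_forall fun H => ?_)
  simp only
  congr 2
  field_simp

/-! ### Termwise angular integration of the hypergeometric series -/

theorem coeffA_mul (N n : ℕ) (a y : ℝ) (p : ℕ) : coeffA N n (a * y) p = coeffA N n a p * y ^ p := by
  rw [coeffA, coeffA, mul_pow]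
  ring

theorem sum_choose_mul_pow (x : ℝ) (N n : ℕ) :
    ∑ m ∈ Finset.range (n + 1), (n.choose m : ℝ) * (-1) ^ m * x ^ (N + n - m)
      = x ^ N * (x - 1) ^ n := by
  rw [sub_eq_neg_add, add_pow, Finset.mul_sum]
  -- The range gives `m ≤ n`, so the truncated subtraction in the exponent is exact.
  refine Finset.sum_congr rfl fun m hm => ?_
  have : N + n - m = N + (n - m) := by
    have := Finset.mem_range.1 hm
    omega
  rw [this, pow_add]
  ring

theorem continuous_ratio {c : ℝ} (hc : 0 < c) :
    Continuous fun θ : ℝ => Real.sin θ ^ 2 / (Real.sin θ ^ 2 + c) :=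
  Continuous.div (by fun_prop) (by fun_prop) fun θ => by positivity

/-- With `x = sin²θ / (sin²θ + c)` the argument of `₁F₁` is `a * (x - 1)`. As `0 ≤ x ≤ 1`, the
absolute series at `a` dominates uniformly in `θ`, and the binomial expansion of `(x - 1) ^ p` gives
the inner sum. -/
theorem hasSum_finiteIntegral {M : ℕ} (hM : 2 ≤ M) {Γ₁ a : ℝ} (hΓ : 0 < Γ₁) (N n : ℕ)
    (hsum : Summable (coeffA N n a)) :
    HasSum (fun p : ℕ => coeffA N n a p * ∑ m ∈ Finset.range (p + 1),
        (p.choose m : ℝ) * (-1) ^ m * finiteIntegral M (N + p - m) Γ₁)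
      (1 / Real.pi * ∫ θ in (0 : ℝ)..(((M : ℝ) - 1) / (M : ℝ) * Real.pi),
        (Real.sin θ ^ 2 / (Real.sin θ ^ 2 + Γ₁ * Real.sin (Real.pi / (M : ℝ)) ^ 2)) ^ N
          * oneFone N n (-(a * Γ₁ * Real.sin (Real.pi / (M : ℝ)) ^ 2
            / (Real.sin θ ^ 2 + Γ₁ * Real.sin (Real.pi / (M : ℝ)) ^ 2)))) := by
  set c := Γ₁ * Real.sin (Real.pi / (M : ℝ)) ^ 2 with hc
  have hc0 : 0 < c := by
    have := sin_pi_div_pos hM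
    positivity
  set b := ((M : ℝ) - 1) / (M : ℝ) * Real.pi with hb
  set x : ℝ → ℝ := fun θ => Real.sin θ ^ 2 / (Real.sin θ ^ 2 + c) with hx
  have hxc : Continuous x := continuous_ratio hc0
  have hx0 : ∀ θ, 0 ≤ x θ := fun θ => by simp only [hx]; positivity
  have hx1 : ∀ θ, x θ ≤ 1 := fun θ => by
    simp only [hx]
    rw [div_le_one (by positivity)]
    linarith
  have hterm : ∀ p : ℕ, coeffA N n a p * ∑ m ∈ Finset.range (p + 1),
      (p.choose m : ℝ) * (-1) ^ m * finiteIntegral M (N + p - m) Γ₁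
      = 1 / Real.pi * ∫ θ in (0 : ℝ)..b, coeffA N n a p * (x θ ^ N * (x θ - 1) ^ p) := by
    intro p
    simp_rw [← sum_choose_mul_pow]
    rw [intervalIntegral.integral_const_mul, intervalIntegral.integral_finsetSum
      (fun m _ => by
        exact (Continuous.mul continuous_const (hxc.pow _)).intervalIntegrable _ _)]
    simp_rw [intervalIntegral.integral_const_mul]
    rw [mul_left_comm, Finset.mul_sum (a := 1 / Real.pi)]
    congr 1
    refine Finset.sum_congr rfl fun m _ => ?_
    rw [finiteIntegral]
    ring
  have hval : ∀ θ, HasSum (fun p : ℕ => coeffA N n a p * (x θ ^ N * (x θ - 1) ^ p))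
      (x θ ^ N * oneFone N n (-(a * Γ₁ * Real.sin (Real.pi / (M : ℝ)) ^ 2
        / (Real.sin θ ^ 2 + c)))) := by
    intro θ
    have e : -(a * Γ₁ * Real.sin (Real.pi / (M : ℝ)) ^ 2 / (Real.sin θ ^ 2 + c))
        = a * (x θ - 1) := by
      have : Real.sin θ ^ 2 + c ≠ 0 := by positivity
      simp only [hx]
      rw [mul_assoc, ← hc]
      field_simp
      ring
    rw [e, oneFone]
    have hs : Summable (coeffA N n (a * (x θ - 1))) := by
      refine Summable.of_norm_bounded hsum.norm fun p => ?_
      rw [coeffA_mul, norm_mul, norm_pow]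
      refine mul_le_of_le_one_right (norm_nonneg _) (pow_le_one₀ (norm_nonneg _) ?_)
      rw [Real.norm_eq_abs, abs_le]
      constructor <;> linarith [hx0 θ, hx1 θ]
    refine (hs.hasSum.mul_left (x θ ^ N)).congr_fun fun p => ?_
    rw [coeffA_mul]
    ring
  simp_rw [hterm]
  refine HasSum.mul_left _ ?_
  refine intervalIntegral.hasSum_integral_of_dominated_convergence
    (fun p _ => ‖coeffA N n a p‖) (fun p => ?_) (fun p => .of_forall fun θ _ => ?_)
    (.of_forall fun θ _ => hsum.norm) intervalIntegrable_const (.of_forall fun θ _ => hval θ)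
  · have : Continuous fun θ => coeffA N n a p * (x θ ^ N * (x θ - 1) ^ p) := by fun_prop
    exact this.aestronglyMeasurable
  · rw [norm_mul, norm_mul, norm_pow, norm_pow]
    refine mul_le_of_le_one_right (norm_nonneg _) (mul_le_one₀ (pow_le_one₀ (norm_nonneg _) ?_)
      (by positivity) (pow_le_one₀ (norm_nonneg _) ?_)) <;>
    · rw [Real.norm_eq_abs, abs_le]
      constructor <;> linarith [hx0 θ, hx1 θ]

theorem posDef_covK {n : ℕ} {K : ℝ} (hK : 0 ≤ K) {RT : Matrix (Fin n) (Fin n) ℂ}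
    (hRT : RT.PosDef) : (covK K RT).PosDef := by
  refine hRT.smul ?_
  have : (0 : ℝ) < 1 / (K + 1) := by positivity
  exact_mod_cast this

end ZF

/-! ### Assembly of the error probability formulas -/

theorem mainTheorem6 {Ω : Type*} [MeasurableSpace Ω] (P : Measure Ω) [IsProbabilityMeasure P]
    -- `L = N_T - 1` interfering streams, `N_T = L + 1 ≤ N_R`, `M`-PSK modulation
    (L NR M : ℕ) (hNR : L + 1 ≤ NR) (hM : 2 ≤ M)
    (K Es N0 : ℝ) (hK : 0 ≤ K) (hEs : 0 < Es) (hN0 : 0 < N0)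
    -- channel mean, transmit correlation, and random part of the channel
    (Hdn : Matrix (Fin NR) (Fin (L + 1)) ℂ)
    (RT : Matrix (Fin (L + 1)) (Fin (L + 1)) ℂ) (hRT : RT.PosDef)
    (Hrn : Ω → Fin NR → Fin (L + 1) → ℂ)
    (hrows : ∀ i, ZF.IsCN P (fun ω => star (Hrn ω i)) 0 RT)
    (hrows_indep : iIndepFun (fun (i : Fin NR) (ω : Ω) => Hrn ω i) P)
    -- receiver noise and transmitted symbols
    (v : Ω → Fin NR → ℂ) (hv : ZF.IsCN P v 0 ((N0 : ℂ) • (1 : Matrix (Fin NR) (Fin NR) ℂ)))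
    (sym : Ω → Fin (L + 1) → Fin M) (hsym : Measurable sym)
    (hHv : IndepFun Hrn v P)
    (hHvsym : IndepFun (fun ω => (Hrn ω, v ω)) sym P)
    (D : ℂ → Fin M) (hD : ZF.IsNearestSymbolDetector M D) :
    let H : Ω → Matrix (Fin NR) (Fin (L + 1)) ℂ :=
      fun ω => ZF.channel K Hdn (Matrix.of (Hrn ω))
    let Hd := ZF.meanMatrix K Hdn
    let R := ZF.covK K RT
    let Γs := ZF.gammaS Es N0 (L + 1)
    let γ₁ : Ω → ℝ := fun ω => ZF.snr Γs (H ω)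
    let Γ₁ := ZF.gamma1 Γs R
    let a := ZF.aParam Hd R
    let N := NR - (L + 1) + 1
    let S := Real.sin (Real.pi / (M : ℝ)) ^ 2
    let Pe := ZF.errorProb P Es D H sym v
    -- the error probability as an average, and through the m.g.f. of the SNR
    (Pe = ∫ ω, ZF.condErrorProb M (γ₁ ω) ∂P ∧
      Pe = 1 / Real.pi * ∫ θ in (0 : ℝ)..(((M : ℝ) - 1) / (M : ℝ) * Real.pi),
        mgf γ₁ P (-(S / Real.sin θ ^ 2))) ∧
    -- Rician--Rayleigh fading
    ((∀ i (k : Fin L), Hd i k.succ = 0) →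
      Pe = 1 / Real.pi * ∫ θ in (0 : ℝ)..(((M : ℝ) - 1) / (M : ℝ) * Real.pi),
        (Real.sin θ ^ 2 / (Real.sin θ ^ 2 + Γ₁ * S)) ^ N
          * ZF.oneFone N NR (-(a * Γ₁ * S / (Real.sin θ ^ 2 + Γ₁ * S))) ∧
      HasSum (fun n : ℕ => ZF.coeffA N NR a n * ∑ m ∈ Finset.range (n + 1),
        (n.choose m : ℝ) * (-1) ^ m * ZF.finiteIntegral M (N + n - m) Γ₁) Pe) ∧
    -- Rayleigh--Rician fading under the mean--correlation condition
    ((∀ i, Hd i 0 = ZF.interfMeanTerm Hd R i) →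
      Pe = ZF.finiteIntegral M N Γ₁) := by
  intro H Hd R Γs γ₁ Γ₁ a N S Pe
  have hR : R.PosDef := ZF.posDef_covK hK hRT
  have hρ := (ZF.PosDef.exists_inv_zero_zero hR).1
  have hΓs : 0 < Γs := by
    simp only [Γs, ZF.gammaS]
    positivity
  have hΓ₁ : 0 < Γ₁ := div_pos hΓs hρ
  have hS : 0 < S := pow_pos (ZF.sin_pi_div_pos hM) 2
  -- `N` is the dimension of the complement of the `L` interfering columns in `ℂ^NR`.
  have hN : N = NR - L := by omega
  have hHrn : Measurable Hrn := by
    refine measurable_pi_lambda _ fun i => ?_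
    have := continuous_star.measurable.comp (hrows i).1
    simpa only [Function.comp_def, star_star] using this
  let m : Fin NR → Fin (L + 1) → ℂ := Hd
  let chan : (Fin NR → Fin (L + 1) → ℂ) → Fin NR → Fin (L + 1) → ℂ := fun G =>
    m + ((Real.sqrt (1 / (K + 1)) : ℝ) : ℂ) • G
  have hchan : Measurable chan := by fun_prop
  let G : Ω → Fin NR → Fin (L + 1) → ℂ := fun ω => chan (Hrn ω)
  have hG : Measurable G := hchan.comp hHrn
  have hν : ZF.MatGauss (P.map G) m R := by
    have h1 := (ZF.matGauss_of_rows hHrn hrows hrows_indep).map_affine m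
      (Real.sqrt (1 / (K + 1)))
    rw [Measure.map_map hchan hHrn, Real.sq_sqrt (by positivity)] at h1
    exact h1
  have pG : IsProbabilityMeasure (P.map G) := Measure.isProbabilityMeasure_map hG.aemeasurable
  have pT : IsProbabilityMeasure ((P.map G).map ZF.tailCols) :=
    Measure.isProbabilityMeasure_map ZF.measurable_tailCols.aemeasurable
  have hcol := hν.ae_colIndep hNR hR
  have hcol' := (hν.tailCols hR).ae_colIndep (by omega) (ZF.posDef_submatrix_succ hR)
  have hγm : Measurable γ₁ := (ZF.measurable_snr Γs).comp hG
  have hPe1 : Pe = ∫ ω, ZF.condErrorProb M (γ₁ ω) ∂P := by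
    have hGv : IndepFun G v P := hHv.comp hchan measurable_id
    have hGvs : IndepFun (fun ω => (G ω, v ω)) sym P :=
      hHvsym.comp ((hchan.comp measurable_fst).prodMk measurable_snd) measurable_id
    have h1 := ZF.errorProb_eq_integral hM hEs hN0 hG hv.1 (ZF.VecGauss.of_isCN hv) hsym hGv hGvs
      hcol hD
    have hcm : AEStronglyMeasurable (fun A : Fin NR → Fin (L + 1) → ℂ =>
        ZF.condErrorProb M (ZF.snr Γs (Matrix.of A))) (P.map G) :=
      ((ZF.measurable_condErrorProb M).comp (ZF.measurable_snr Γs)).aestronglyMeasurable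
    rw [integral_map hG.aemeasurable hcm] at h1
    exact h1
  have hPe2 : Pe = 1 / Real.pi * ∫ θ in (0 : ℝ)..(((M : ℝ) - 1) / (M : ℝ) * Real.pi),
      mgf γ₁ P (-(S / Real.sin θ ^ 2)) := by
    rw [hPe1]
    exact ZF.integral_condErrorProb M hγm fun ω => ZF.snr_nonneg hΓs.le _
  -- Both fading cases start here: they differ only in how the remaining average over the
  -- interfering columns is evaluated.
  have hmgf : ∀ θ, 0 < Real.sin θ → mgf γ₁ P (-(S / Real.sin θ ^ 2))
      = (Real.sin θ ^ 2 / (Real.sin θ ^ 2 + Γ₁ * S)) ^ N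
        * ∫ A, Real.exp (-(Γs * S / (Real.sin θ ^ 2 + Γ₁ * S)
          * ZF.snr 1 (ZF.consCol (ZF.muVec Hd R) A))) ∂((P.map G).map ZF.tailCols) := by
    intro θ hθ
    rw [hN]
    have h1 := hν.integral_exp_neg_snr (by omega) hR hΓs hS (pow_pos hθ 2)
    rw [integral_map hG.aemeasurable (by
      exact (Real.measurable_exp.comp
        ((ZF.measurable_snr Γs).const_mul _)).aestronglyMeasurable)] at h1
    exact h1
  refine ⟨⟨hPe1, hPe2⟩, fun hRay => ?_, fun hcond => ?_⟩
  · have hν2 : ZF.MatGauss ((P.map G).map ZF.tailCols) 0 (R.submatrix Fin.succ Fin.succ) := by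
      have h1 := hν.tailCols hR
      have h2 : ZF.tailCols m = 0 := by
        ext i j
        exact hRay i j
      rwa [h2] at h1
    have hnorm : a = ((R⁻¹) 0 0).re
        * ‖(WithLp.toLp 2 (ZF.muVec Hd R) : EuclideanSpace ℂ (Fin NR))‖ ^ 2 := by
      rw [EuclideanSpace.norm_sq_eq]
      rfl
    have hser := fun c => hν2.hasSum_coeffA (by omega) (ZF.posDef_submatrix_succ hR) c
      (WithLp.toLp 2 (ZF.muVec Hd R))
    have hPe3 : Pe = 1 / Real.pi * ∫ θ in (0 : ℝ)..(((M : ℝ) - 1) / (M : ℝ) * Real.pi),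
        (Real.sin θ ^ 2 / (Real.sin θ ^ 2 + Γ₁ * S)) ^ N
          * ZF.oneFone N NR (-(a * Γ₁ * S / (Real.sin θ ^ 2 + Γ₁ * S))) := by
      rw [hPe2]
      congr 1
      refine ZF.integral_congr_of_sin_pos hM fun θ hθ => ?_
      rw [hmgf θ hθ]
      congr 1
      rw [← (hser _).tsum_eq, ZF.oneFone, hN]
      have e : Γs * S / (Real.sin θ ^ 2 + Γ₁ * S)
          * ‖(WithLp.toLp 2 (ZF.muVec Hd R) : EuclideanSpace ℂ (Fin NR))‖ ^ 2
          = a * Γ₁ * S / (Real.sin θ ^ 2 + Γ₁ * S) := by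
        have : a * Γ₁ = Γs
            * ‖(WithLp.toLp 2 (ZF.muVec Hd R) : EuclideanSpace ℂ (Fin NR))‖ ^ 2 := by
          rw [hnorm, show Γ₁ = Γs / ((R⁻¹) 0 0).re from rfl]
          field_simp
        rw [this]
        ring
      rw [e]
    refine ⟨hPe3, ?_⟩
    rw [hPe3]
    refine ZF.hasSum_finiteIntegral hM hΓ₁ N NR ?_
    -- This negative value of `c` makes the argument `-(c * ‖μ‖ ^ 2)` equal to `a`.
    have h3 := (hser (-((R⁻¹) 0 0).re)).summable
    rwa [neg_mul, neg_neg, ← hnorm, ← hN] at h3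
  · have hμ : ZF.muVec Hd R = 0 := by
      ext i
      simp [ZF.muVec, hcond i]
    rw [hPe2, ZF.finiteIntegral]
    congr 1
    refine ZF.integral_congr_of_sin_pos hM fun θ hθ => ?_
    rw [hmgf θ hθ, hμ]
    -- The projection of the zero vector vanishes whatever the interfering columns are, so their
    -- mean plays no role.
    have e : ∀ᵐ A ∂((P.map G).map ZF.tailCols),
        Real.exp (-(Γs * S / (Real.sin θ ^ 2 + Γ₁ * S) * ZF.snr 1 (ZF.consCol 0 A))) = 1 := by
      filter_upwards [hcol'] with A hA
      rw [ZF.snr_consCol 1 _ hA]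
      simp
    rw [integral_congr_ae e, integral_const, probReal_univ, one_smul, mul_one]
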